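/- Let $F$ be a non-archimedean local field with ring of integers $\mathcal O$, uniformizer $\varpi$, residue field of cardinality $q$, and normalized absolute value $|\cdot|$ (so $|\varpi|=q^{-1}$), and let $K=\mathrm{GL}_2(\mathcal O)$. Let $dx$, $d^\times x$, $dk$ be the Haar measures on $F$, $F^\times$, $K$ giving $\mathcal O$, $\mathcal O^\times$, $K$ volume $1$. Let $\psi$ be an unramified additive character of $F$, i.e. $\mathcal O$ is the largest fractional ideal on which $\psi$ is trivial. A quasi-character of $F^\times$ is unramified if it is trivial on $\mathcal O^\times$. For $i=1,2$ let $\pi_i$ be a spherical representation of $\mathrm{GL}_2(F)$, i.e. an irreducible smooth complex representation with a nonzero $K$-fixed vector, and let $\chi_i,\chi_i'$ be unramified quasi-characters such that $\pi_i$ is a constituent (subquotient) of the normalized induced representation $\mathrm{Ind}(\chi_i\otimes\chi_i')$. For an unramified quasi-character $\mu$ put $$L(s,\pi_i,\mu)=\frac{1}{(1-\chi_i(\varpi)\mu(\varpi)q^{-s})(1-\chi_i'(\varpi)\mu(\varpi)q^{-s})}.$$ Suppose that the central characters satisfy $\omega_{\pi_1}\omega_{\pi_2}=1$. Let $W_i\in\mathcal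 W(\pi_i,\psi)$ be the normalized $K$-fixed vector of the Whittaker model: $W_i(g)=\lambda_i(\pi_i(g)v_i)$ for some $v_i$ in the space of $\pi_i$ and some nonzero linear functional $\lambda_i$ with $\lambda_i\left(\pi_i\begin{pmatrix}1&x\\&1\end{pmatrix}v\right)=\psi(x)\lambda_i(v)$ for all $x\in F$ and all $v$; moreover $W_i(gk)=W_i(g)$ for $k\in K$, and $W_i(1)=1$. Let $f$ be the characteristic function of $\mathrm M_2(\mathcal O)\times \mathrm M_2(\mathcal O)$. For an unramified quasi-character $\mu$ and $s_1,s_2\in\mathbb C$ set $$\begin{aligned}\mathcal Z(W_1,W_2,f;\mu,|\cdot|^{s_1},|\cdot|^{s_2})=\int_{F^2}\int_{F^\times}\int_{K^2}& f\left(k_1^{-1}\begin{pmatrix}\epsilon^{-1}&\epsilon^{-1}v\\0&0\end{pmatrix}k_2,\;k_1^{-1}\begin{pmatrix}0&-u\epsilon\\0&\epsilon\end{pmatrix}k_2\right)\omega_{\pi_2}(\epsilon)|\epsilon|^{2s_2-2}\\ &\cdot\left(\int_{F^\times}W_1\left(\begin{pmatrix}\alpha&\\&1\end{pmatrix}k_1\right)\psi(u\alpha)\mu(\alpha)|\alpha|^{s_1-\frac12}\,d^\times\alpha\right)\\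 &\cdot\left(\int_{F^\times}W_2\left(\begin{pmatrix}\beta&\\&1\end{pmatrix}k_2\right)\psi(v\beta)\mu^{-1}(\beta)|\beta|^{s_2-\frac12}\,d^\times\beta\right)dk_1\,dk_2\,d^\times\epsilon\,du\,dv.\end{aligned}$$ Then for all $s_1,s_2$ with $q^{\Re s_1}>\max(|\chi_1(\varpi)\mu(\varpi)|,|\chi_1'(\varpi)\mu(\varpi)|)$ and $q^{\Re s_2}>\max(|\chi_2(\varpi)\mu(\varpi)^{-1}|,|\chi_2'(\varpi)\mu(\varpi)^{-1}|)$ (in particular for $\Re s_1,\Re s_2$ large), the inner integrals (for all $k_1,k_2\in K$ and $u,v\in F$) and the outer integral converge absolutely, and $$\mathcal Z(W_1,W_2,f;\mu,|\cdot|^{s_1},|\cdot|^{s_2})=L(s_1,\pi_1,\mu)\,L(s_2,\pi_2,\mu^{-1}).$$ -/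

import Mathlib

open scoped MatrixGroups

noncomputable section

namespace LocalGL2

open ValuativeRel MeasureTheory Matrix

section Field

variable (F : Type*) [Field F] [ValuativeRel F] [TopologicalSpace F]
  [IsNonarchimedeanLocalField F]

/-- The cardinality `q` of the residue field. -/
def resCard : ℕ := Nat.card 𝓀[F]

theorem resCard_ne_zero : ((resCard F : ℕ) : NNReal) ≠ 0 := by
  have : resCard F ≠ 0 := Nat.card_pos.ne'
  exact_mod_cast this

variable {F}

/-- The normalized absolute value: `|ϖ| = q⁻¹` for a uniformizer `ϖ`. -/
def nabs (x : F) : ℝ :=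
  WithZeroMulInt.toNNReal (resCard_ne_zero F)
    (IsNonarchimedeanLocalField.valueGroupWithZeroIsoInt F (valuation F x))

/-- `|x|^s` for `x ∈ Fˣ` and a complex exponent `s`. -/
def nabsPow (x : Fˣ) (s : ℂ) : ℂ := ((nabs (x : F) : ℝ) : ℂ) ^ s

end Field

section Characters

variable {F : Type*} [Field F] [ValuativeRel F]

/-- `ϖ` is a uniformizer, i.e. a prime element of the ring of integers. -/
def IsUniformizer (ϖ : Fˣ) : Prop :=
  ∃ h : (ϖ : F) ∈ 𝒪[F], Irreducible (⟨ϖ, h⟩ : 𝒪[F])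

/-- The quasi-character `χ` of `Fˣ` is unramified: it is trivial on the units of `𝒪[F]`
(in particular it is continuous). -/
def IsUnramifiedChar (χ : Fˣ →* ℂˣ) : Prop :=
  ∀ x : Fˣ, valuation F (x : F) = 1 → χ x = 1

/-- The additive character `ψ` is unramified: `𝒪[F]` is the largest fractional ideal on which
it is trivial (in particular it is continuous and nontrivial). -/
def IsUnramifiedAddChar (ψ : AddChar F Circle) : Prop :=
  ∀ a : F, (∀ x ∈ 𝒪[F], ψ (a * x) = 1) ↔ a ∈ 𝒪[F]

end Characters

section Group

variable {F : Type*} [Field F]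

/-- The diagonal matrix `diag(a, d)`. -/
def diag (a d : Fˣ) : GL (Fin 2) F where
  val := !![(a : F), 0; 0, (d : F)]
  inv := !![((a⁻¹ : Fˣ) : F), 0; 0, ((d⁻¹ : Fˣ) : F)]
  val_inv := by ext i j; fin_cases i <;> fin_cases j <;> simp
  inv_val := by ext i j; fin_cases i <;> fin_cases j <;> simp

/-- The unipotent matrix `(1 x; 0 1)`. -/
def unip (x : F) : GL (Fin 2) F := GeneralLinearGroup.upperRightHom x

variable (F) [ValuativeRel F]

/-- The maximal compact subgroup `K = GL₂(𝒪)` of `GL₂(F)`. -/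
def maxCompact : Subgroup (GL (Fin 2) F) :=
  (GeneralLinearGroup.map (n := Fin 2) (𝒪[F]).subtype).range

/-- The set `M₂(𝒪)` of integral matrices. -/
def integralMatrices : Set (Matrix (Fin 2) (Fin 2) F) :=
  {M | ∀ i j, M i j ∈ 𝒪[F]}

/-- The characteristic function of `M₂(𝒪) × M₂(𝒪)`. -/
def charFun (p : Matrix (Fin 2) (Fin 2) F × Matrix (Fin 2) (Fin 2) F) : ℂ :=
  (integralMatrices F ×ˢ integralMatrices F).indicator 1 p

end Group

section Representations

variable {F : Type*} [Field F] [ValuativeRel F] [TopologicalSpace F]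
  {V : Type*} [AddCommGroup V] [Module ℂ V]

/-- A representation of `GL₂(F)` is smooth if every vector is fixed by an open subgroup. -/
def IsSmooth (π : Representation ℂ (GL (Fin 2) F) V) : Prop :=
  ∀ v : V, ∃ U : Subgroup (GL (Fin 2) F), IsOpen (U : Set (GL (Fin 2) F)) ∧
    ∀ u ∈ U, π u v = v

/-- A spherical representation: irreducible, smooth, with a nonzero `K`-fixed vector. -/
structure IsSpherical (π : Representation ℂ (GL (Fin 2) F) V) : Prop where
  irreducible : π.IsIrreducible
  smooth : IsSmooth π
  exists_fixed : ∃ v : V, v ≠ 0 ∧ ∀ k ∈ maxCompact F, π k v = v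

/-- `ω` is the central character of `π`. -/
def IsCentralChar (π : Representation ℂ (GL (Fin 2) F) V) (ω : Fˣ →* ℂˣ) : Prop :=
  ∀ (z : Fˣ) (v : V), π (GeneralLinearGroup.scalar (Fin 2) z) v = (ω z : ℂ) • v

/-- `l` is a `ψ`-Whittaker functional on `π`. -/
def IsWhittakerFunctional (π : Representation ℂ (GL (Fin 2) F) V) (ψ : AddChar F Circle)
    (l : V →ₗ[ℂ] ℂ) : Prop :=
  ∀ (x : F) (v : V), l (π (unip x) v) = (ψ x : ℂ) * l v

/-- The Whittaker model `𝒲(π, ψ)`: the functions `g ↦ l (π(g) v)`, for a nonzero `ψ`-Whittaker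
functional `l` and `v ∈ π`. -/
def whittakerModel (π : Representation ℂ (GL (Fin 2) F) V) (ψ : AddChar F Circle) :
    Set (GL (Fin 2) F → ℂ) :=
  {W | ∃ l : V →ₗ[ℂ] ℂ, l ≠ 0 ∧ IsWhittakerFunctional π ψ l ∧ ∃ v : V, W = fun g => l (π g v)}

/-- `W` is right `K`-invariant and normalized by `W(1) = 1`. -/
def IsNormalizedSpherical (W : GL (Fin 2) F → ℂ) : Prop :=
  (∀ g, ∀ k ∈ maxCompact F, W (g * k) = W g) ∧ W 1 = 1

variable [IsNonarchimedeanLocalField F]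

/-- The space of the normalized induced representation `Ind(χ₁ ⊗ χ₂)`: functions `φ` on `GL₂(F)`,
right invariant under some open subgroup, with
`φ((a b; 0 d) g) = χ₁(a) χ₂(d) |a/d|^{1/2} φ(g)`. -/
def indSpace (χ₁ χ₂ : Fˣ →* ℂˣ) : Submodule ℂ (GL (Fin 2) F → ℂ) where
  carrier := {φ |
    (∀ (x : F) (a d : Fˣ) (g : GL (Fin 2) F),
      φ (unip x * diag a d * g) = (χ₁ a : ℂ) * (χ₂ d : ℂ) * nabsPow (a / d) (1 / 2) * φ g) ∧
    ∃ U : Subgroup (GL (Fin 2) F), IsOpen (U : Set (GL (Fin 2) F)) ∧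
      ∀ u ∈ U, ∀ g, φ (g * u) = φ g}
  add_mem' := by
    rintro φ φ' ⟨h, U, hU, hφ⟩ ⟨h', U', hU', hφ'⟩
    refine ⟨fun x a d g => ?_, U ⊓ U', hU.inter hU', fun u hu g => ?_⟩
    · simp only [Pi.add_apply, h, h', mul_add]
    · simp only [Pi.add_apply, hφ u hu.1, hφ' u hu.2]
  zero_mem' := ⟨fun x a d g => by simp, ⊤, isOpen_univ, fun u _ g => rfl⟩
  smul_mem' := by
    rintro c φ ⟨h, U, hU, hφ⟩
    refine ⟨fun x a d g => ?_, U, hU, fun u hu g => ?_⟩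
    · simp only [Pi.smul_apply, h, smul_eq_mul]; ring
    · simp only [Pi.smul_apply, hφ u hu]

theorem indSpace_translate (χ₁ χ₂ : Fˣ →* ℂˣ) (h : GL (Fin 2) F) {φ : GL (Fin 2) F → ℂ}
    (hφ : φ ∈ indSpace χ₁ χ₂) : (fun g => φ (g * h)) ∈ indSpace χ₁ χ₂ := by
  obtain ⟨h1, U, hU, h2⟩ := hφ
  refine ⟨fun x a d g => ?_, U.comap (MulAut.conj h⁻¹).toMonoidHom, ?_, fun u hu g => ?_⟩
  · simp only [mul_assoc] at h1 ⊢
    exact h1 x a d (g * h)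
  · have hc : Continuous fun u : GL (Fin 2) F => h⁻¹ * u * h := by fun_prop
    have := hU.preimage hc
    convert this using 1
    ext u
    simp
  · have hu' : h⁻¹ * u * h ∈ U := by simpa using hu
    have := h2 _ hu' (g * h)
    simpa [mul_assoc] using this

/-- The normalized induced representation `Ind(χ₁ ⊗ χ₂)`, by right translation. -/
def ind (χ₁ χ₂ : Fˣ →* ℂˣ) : Representation ℂ (GL (Fin 2) F) (indSpace χ₁ χ₂) where
  toFun h :=
    { toFun := fun φ => ⟨fun g => φ.1 (g * h), indSpace_translate χ₁ χ₂ h φ.2⟩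
      map_add' := fun _ _ => rfl
      map_smul' := fun _ _ => rfl }
  map_one' := by ext φ g; simp
  map_mul' := fun h h' => by ext φ g; simp [mul_assoc]

/-- `π` is a constituent (subquotient) of `Ind(χ₁ ⊗ χ₂)`: the image under an intertwining map of
a subrepresentation. -/
def IsConstituentOfInd (π : Representation ℂ (GL (Fin 2) F) V) (χ₁ χ₂ : Fˣ →* ℂˣ) : Prop :=
  ∃ (N : Subrepresentation (ind χ₁ χ₂))
    (p : Representation.IntertwiningMap N.toRepresentation π), Function.Surjective p

/-- `(χ₁, χ₂)` are Satake parameters of the spherical representation `π`: unramified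
quasi-characters such that `π` is a constituent of `Ind(χ₁ ⊗ χ₂)`. -/
structure IsSatake (π : Representation ℂ (GL (Fin 2) F) V) (χ₁ χ₂ : Fˣ →* ℂˣ) : Prop where
  unramified₁ : IsUnramifiedChar χ₁
  unramified₂ : IsUnramifiedChar χ₂
  constituent : IsConstituentOfInd π χ₁ χ₂

end Representations

section Zeta

variable {F : Type*} [Field F] [ValuativeRel F] [TopologicalSpace F]
  [IsNonarchimedeanLocalField F]

/-- The factor `(1 - χ(ϖ) q^{-s})⁻¹` of an unramified quasi-character `χ`. -/
def tateL (ϖ : Fˣ) (χ : Fˣ →* ℂˣ) (s : ℂ) : ℂ :=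
  (1 - (χ ϖ : ℂ) * (resCard F : ℂ) ^ (-s))⁻¹

/-- The local factor `L(s, π, μ)` of the spherical representation `π` with Satake parameters
`(χ₁, χ₂)`, twisted by the unramified quasi-character `μ`. -/
def sphericalL (ϖ : Fˣ) (χ₁ χ₂ μ : Fˣ →* ℂˣ) (s : ℂ) : ℂ :=
  tateL ϖ (χ₁ * μ) s * tateL ϖ (χ₂ * μ) s

/-- The integrand of `innerZeta`. -/
def innerIntegrand (ψ : AddChar F Circle) (W : GL (Fin 2) F → ℂ) (k : GL (Fin 2) F) (u : F)
    (μ : Fˣ →* ℂˣ) (s : ℂ) (α : Fˣ) : ℂ :=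
  W (diag α 1 * k) * (ψ (u * α) : ℂ) * (μ α : ℂ) * nabsPow α (s - 1 / 2)

variable [MeasurableSpace F]

/-- `∫_{Fˣ} W(diag(α, 1) k) ψ(uα) μ(α) |α|^{s - 1/2} d^×α`. -/
def innerZeta (dt : Measure Fˣ) (ψ : AddChar F Circle) (W : GL (Fin 2) F → ℂ)
    (k : GL (Fin 2) F) (u : F) (μ : Fˣ →* ℂˣ) (s : ℂ) : ℂ :=
  ∫ α, innerIntegrand ψ W k u μ s α ∂dt

/-- The integrand of the two-variable zeta integral at `(u, v, ε, k₁, k₂)`. -/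
def zetaIntegrand (dt : Measure Fˣ) (ψ : AddChar F Circle) (W₁ W₂ : GL (Fin 2) F → ℂ)
    (f : Matrix (Fin 2) (Fin 2) F × Matrix (Fin 2) (Fin 2) F → ℂ) (ω₂ μ : Fˣ →* ℂˣ)
    (s₁ s₂ : ℂ) (p : F × F × Fˣ × maxCompact F × maxCompact F) : ℂ :=
  match p with
  | (u, v, ε, k₁, k₂) =>
    f (((k₁⁻¹ : maxCompact F) : GL (Fin 2) F).val *
          !![((ε⁻¹ : Fˣ) : F), ((ε⁻¹ : Fˣ) : F) * v; 0, 0] * (k₂ : GL (Fin 2) F).val,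
       ((k₁⁻¹ : maxCompact F) : GL (Fin 2) F).val *
          !![0, -(u * (ε : F)); 0, (ε : F)] * (k₂ : GL (Fin 2) F).val) *
      (ω₂ ε : ℂ) * nabsPow ε (2 * s₂ - 2) *
      innerZeta dt ψ W₁ k₁ u μ s₁ * innerZeta dt ψ W₂ k₂ v μ⁻¹ s₂

variable [MeasurableSpace (GL (Fin 2) F)]

/-- The product measure `du dv d^×ε dk₁ dk₂`. -/
def zetaMeasure (dx : Measure F) (dt : Measure Fˣ) (dk : Measure (maxCompact F)) :
    Measure (F × F × Fˣ × maxCompact F × maxCompact F) :=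
  dx.prod (dx.prod (dt.prod (dk.prod dk)))

/-- The two-variable zeta integral `𝒵(W₁, W₂, f; μ, |.|^{s₁}, |.|^{s₂})`, where `ω₂` is the central
character of the representation that `W₂` belongs to. -/
def zetaIntegral (dx : Measure F) (dt : Measure Fˣ) (dk : Measure (maxCompact F))
    (ψ : AddChar F Circle) (W₁ W₂ : GL (Fin 2) F → ℂ)
    (f : Matrix (Fin 2) (Fin 2) F × Matrix (Fin 2) (Fin 2) F → ℂ) (ω₂ μ : Fˣ →* ℂˣ)
    (s₁ s₂ : ℂ) : ℂ :=
  ∫ p, zetaIntegrand dt ψ W₁ W₂ f ω₂ μ s₁ s₂ p ∂(zetaMeasure dx dt dk)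

/-- All the integrals in the definition of `zetaIntegral` converge absolutely. -/
def ZetaConverges (dx : Measure F) (dt : Measure Fˣ) (dk : Measure (maxCompact F))
    (ψ : AddChar F Circle) (W₁ W₂ : GL (Fin 2) F → ℂ)
    (f : Matrix (Fin 2) (Fin 2) F × Matrix (Fin 2) (Fin 2) F → ℂ) (ω₂ μ : Fˣ →* ℂˣ)
    (s₁ s₂ : ℂ) : Prop :=
  (∀ k ∈ maxCompact F, ∀ u : F, Integrable (innerIntegrand ψ W₁ k u μ s₁) dt) ∧
  (∀ k ∈ maxCompact F, ∀ v : F, Integrable (innerIntegrand ψ W₂ k v μ⁻¹ s₂) dt) ∧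
  Integrable (zetaIntegrand dt ψ W₁ W₂ f ω₂ μ s₁ s₂) (zetaMeasure dx dt dk)

end Zeta

end LocalGL2

end

open LocalGL2 ValuativeRel MeasureTheory

/-! The zeta integrand is a constant multiple of an indicator function. Left and right
multiplication by `K` preserves `M₂(𝒪)`, so `k₁` and `k₂` drop out of `f`. They drop out of the
Whittaker functions by right invariance. Integrality of the two matrices makes both `ε` and `ε⁻¹`
integral, so `ε` is a unit, and then `u`, `v` are integral. This set has volume one. On it the
factors in `ε` are trivial, and so are `ψ(uα)` and `ψ(vβ)`, because `W(diag(α, 1))` vanishes for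
non-integral `α`. What is left is a product of two Mellin transforms of spherical Whittaker
functions.

Each transform is an `L`-factor because `q^{n/2} W(diag(ϖⁿ, 1))` is the complete homogeneous
symmetric polynomial `hₙ(X, Y)` in the Satake parameters, whose generating series is `(1 - Xt)⁻¹(1 -
Yt)⁻¹`. The formula comes from the Hecke operator of `K diag(ϖ, 1) K`, whose eigenvalue `q^{1/2}(X +
Y)` is computed in the induced representation (`hecke_ind`). It passes to the constituent because
`K`-fixed vectors lift through quotients (`exists_fixed_lift`). Evaluated along the torus, the
eigenvalue equation is the recurrence of the `hₙ` (`IsSphericalWhittaker.hecke_diag`,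
`completeSymm_add_two`). Irreducibility ensures that the vector behind `W` is itself `K`-fixed
(`fixed_of_coefficient_invariant`). -/

noncomputable section

namespace LocalGL2

open ValuativeRel MeasureTheory Matrix

/-! ### The integer-valued valuation and the normalized absolute value. -/

section Valuation

variable {F : Type*} [Field F] [ValuativeRel F] [TopologicalSpace F]
  [IsNonarchimedeanLocalField F]

/-- The normalized additive valuation on `Fˣ`. -/
def ord (x : Fˣ) : ℤ :=
  -WithZero.log (IsNonarchimedeanLocalField.valueGroupWithZeroIsoInt F (valuation F (x : F)))

theorem iso_valuation_ne_zero (x : Fˣ) :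
    IsNonarchimedeanLocalField.valueGroupWithZeroIsoInt F (valuation F (x : F)) ≠ 0 := by
  simp

theorem iso_valuation_eq (x : Fˣ) :
    IsNonarchimedeanLocalField.valueGroupWithZeroIsoInt F (valuation F (x : F)) =
      WithZero.exp (-ord x) := by
  rw [ord, neg_neg, WithZero.exp_log (iso_valuation_ne_zero x)]

theorem ord_mul (x y : Fˣ) : ord (x * y) = ord x + ord y := by
  simp only [ord, Units.val_mul, map_mul]
  rw [WithZero.log_mul (iso_valuation_ne_zero x) (iso_valuation_ne_zero y)]
  ring

/-- The normalized additive valuation as a homomorphism. -/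
def ordHom : Fˣ →* Multiplicative ℤ :=
  MonoidHom.mk' (fun x => Multiplicative.ofAdd (ord x)) fun x y => by
    rw [ord_mul, ofAdd_add]

theorem ord_zpow (x : Fˣ) (n : ℤ) : ord (x ^ n) = n * ord x := by
  have := congrArg Multiplicative.toAdd (map_zpow ordHom x n)
  simpa [ordHom] using this

theorem ord_inv (x : Fˣ) : ord x⁻¹ = -ord x := by
  simpa using ord_zpow x (-1)

theorem valuation_le_valuation_iff (x y : Fˣ) :
    valuation F (x : F) ≤ valuation F (y : F) ↔ ord y ≤ ord x := by
  rw [← (IsNonarchimedeanLocalField.valueGroupWithZeroIsoInt F).strictMono.le_iff_le,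
    iso_valuation_eq, iso_valuation_eq, WithZero.exp_le_exp]
  exact neg_le_neg_iff

theorem ord_one : ord (1 : Fˣ) = 0 := by
  simp [ord]

theorem valuation_le_one_iff (x : Fˣ) : valuation F (x : F) ≤ 1 ↔ 0 ≤ ord x := by
  simpa [ord_one] using valuation_le_valuation_iff x 1

theorem valuation_eq_one_iff (x : Fˣ) : valuation F (x : F) = 1 ↔ ord x = 0 := by
  rw [le_antisymm_iff, valuation_le_one_iff]
  have := valuation_le_valuation_iff 1 x
  simp only [Units.val_one, map_one, ord_one] at this
  rw [this]
  omega

theorem nabs_eq (x : Fˣ) : nabs (x : F) = (resCard F : ℝ) ^ (-ord x) := by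
  rw [nabs, iso_valuation_eq, WithZeroMulInt.toNNReal_neg_apply _ WithZero.exp_ne_zero]
  simp only [NNReal.coe_zpow, NNReal.coe_natCast]
  congr 1

theorem one_lt_resCard : 1 < resCard F := Finite.one_lt_card

/-- With an integer outer exponent, the Mellin integrals below become power series in `q^{-s}`. -/
theorem nabsPow_eq (x : Fˣ) (s : ℂ) : nabsPow x s = ((resCard F : ℂ) ^ (-s)) ^ ord x := by
  have hq : (0 : ℝ) < resCard F := by exact_mod_cast (zero_lt_one.trans (one_lt_resCard (F := F)))
  have hq' : (resCard F : ℂ) ≠ 0 := by exact_mod_cast hq.ne'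
  have hp : (0 : ℝ) < (resCard F : ℝ) ^ (-ord x) := zpow_pos hq _
  rw [nabsPow, nabs_eq, Complex.cpow_def_of_ne_zero (by exact_mod_cast hp.ne'),
    Complex.cpow_def_of_ne_zero hq', ← Complex.ofReal_log hp.le, Real.log_zpow,
    ← Complex.exp_int_mul, ← Complex.natCast_log]
  congr 1
  push_cast
  ring

theorem ord_uniformizer {ϖ : Fˣ} (hϖ : IsUniformizer ϖ) : ord ϖ = 1 := by
  obtain ⟨h, hirr⟩ := hϖ
  obtain ⟨y, hy⟩ := valuation_surjective (K := F)
    ((IsNonarchimedeanLocalField.valueGroupWithZeroIsoInt F).symm (WithZero.exp (-1)))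
  have hy0 : y ≠ 0 := by
    rintro rfl
    rw [map_zero, eq_comm, map_eq_zero] at hy
    exact WithZero.exp_ne_zero hy
  obtain ⟨y, rfl⟩ : ∃ z : Fˣ, (z : F) = y := ⟨Units.mk0 y hy0, rfl⟩
  have hy1 : ord y = 1 := by
    rw [ord, hy]; simp
  have hϖ0 : 0 ≤ ord ϖ := (valuation_le_one_iff ϖ).1 h
  have hϖ1 : ord ϖ ≠ 0 := by
    intro h0
    apply hirr.not_isUnit
    rw [Valuation.Integers.isUnit_iff_valuation_eq_one (Valuation.integer.integers (valuation F))]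
    exact (valuation_eq_one_iff ϖ).2 h0
  -- An element of order one lies in the maximal ideal, which `ϖ` generates; divisibility bounds
  -- `ord ϖ` by one.
  have hym : (⟨y, (valuation_le_one_iff y).2 (by omega)⟩ : 𝒪[F]) ∈
      IsLocalRing.maximalIdeal 𝒪[F] := by
    rw [IsLocalRing.mem_maximalIdeal, mem_nonunits_iff,
      Valuation.Integers.isUnit_iff_valuation_eq_one (Valuation.integer.integers (valuation F))]
    intro h1
    have := (valuation_eq_one_iff y).1 h1
    omega
  rw [hirr.maximalIdeal_eq, Ideal.mem_span_singleton] at hym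
  obtain ⟨c, hc⟩ := hym
  have hc' : (y : F) = ϖ * c := congrArg Subtype.val hc
  have := (valuation_le_valuation_iff y ϖ).1 (by
    rw [hc', map_mul]
    exact mul_le_of_le_one_right' c.2)
  omega

end Valuation

/-! ### Matrix identities, the group `K` and the Iwasawa decomposition. -/

section MaxCompact

variable {F : Type*} [Field F]

theorem unip_val (x : F) : (unip x).val = !![1, x; 0, 1] := by
  simp [unip]

theorem diag_val (a d : Fˣ) : (diag a d).val = !![(a : F), 0; 0, (d : F)] := rfl

theorem diag_mul (a d a' d' : Fˣ) : diag a d * diag a' d' = diag (a * a') (d * d') := by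
  ext i j
  fin_cases i <;> fin_cases j <;> simp [diag_val]

theorem diag_one : diag (1 : Fˣ) 1 = 1 := by
  ext i j
  fin_cases i <;> fin_cases j <;> simp [diag_val]

theorem unip_zero : unip (0 : F) = 1 := by
  ext i j
  fin_cases i <;> fin_cases j <;> simp [unip_val]

theorem unip_mul (x y : F) : unip x * unip y = unip (x + y) := by
  ext i j
  fin_cases i <;> fin_cases j <;> simp [unip_val, add_comm]

theorem diag_mul_unip (a : Fˣ) (x : F) : diag a 1 * unip x = unip (a * x) * diag a 1 := by
  ext i j
  fin_cases i <;> fin_cases j <;> simp [unip_val, diag_val]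

theorem scalar_eq_diag (a : Fˣ) : GeneralLinearGroup.scalar (Fin 2) a = diag a a := by
  ext i j
  fin_cases i <;> fin_cases j <;> simp [diag_val]

theorem det_val_ne_zero (g : GL (Fin 2) F) : g.val.det ≠ 0 :=
  ((Matrix.isUnit_iff_isUnit_det _).1 g.isUnit).ne_zero

theorem upperTriangular_eq {g : GL (Fin 2) F} (hg : g.val 1 0 = 0) :
    ∃ (x : F) (a d : Fˣ), g = unip x * diag a d := by
  have hdet := det_val_ne_zero g
  rw [Matrix.det_fin_two, hg, mul_zero, sub_zero] at hdet
  have ha := left_ne_zero_of_mul hdet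
  have hd := right_ne_zero_of_mul hdet
  refine ⟨g.val 0 1 / g.val 1 1, Units.mk0 _ ha, Units.mk0 _ hd, ?_⟩
  ext i j
  fin_cases i <;> fin_cases j <;> simp [unip_val, diag_val, hg, hd]

variable [ValuativeRel F]

theorem mem_maxCompact_iff (g : GL (Fin 2) F) :
    g ∈ maxCompact F ↔ (∀ i j, g.val i j ∈ 𝒪[F]) ∧ valuation F g.val.det = 1 := by
  constructor
  · rintro ⟨k, rfl⟩
    refine ⟨fun i j => (k.val i j).2, ?_⟩
    have h1 : (GeneralLinearGroup.map (n := Fin 2) (𝒪[F]).subtype k).val.det =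
        ((k.val.det : 𝒪[F]) : F) := by
      simp [Matrix.det_fin_two]
    rw [h1]
    have hu : IsUnit k.val.det := (Matrix.isUnit_iff_isUnit_det _).1 k.isUnit
    exact (Valuation.Integers.isUnit_iff_valuation_eq_one
      (Valuation.integer.integers (valuation F))).1 hu
  · rintro ⟨h, hd⟩
    let A : Matrix (Fin 2) (Fin 2) 𝒪[F] := fun i j => ⟨g.val i j, h i j⟩
    have hA : ((A.det : 𝒪[F]) : F) = g.val.det := by
      rw [Matrix.det_fin_two, Matrix.det_fin_two]
      rfl
    have hu : IsUnit A.det := by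
      rw [Valuation.Integers.isUnit_iff_valuation_eq_one
        (Valuation.integer.integers (valuation F))]
      change valuation F ((A.det : 𝒪[F]) : F) = 1
      rw [hA, hd]
    refine ⟨GeneralLinearGroup.mk'' A hu, ?_⟩
    ext i j
    rfl

theorem integralMatrices_mul {A B : Matrix (Fin 2) (Fin 2) F} (hA : A ∈ integralMatrices F)
    (hB : B ∈ integralMatrices F) : A * B ∈ integralMatrices F := by
  intro i j
  rw [Matrix.mul_apply]
  exact sum_mem fun k _ => mul_mem (hA i k) (hB k j)

theorem integralMatrices_of_mem_maxCompact {k : GL (Fin 2) F} (hk : k ∈ maxCompact F) :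
    k.val ∈ integralMatrices F := ((mem_maxCompact_iff k).1 hk).1

theorem conj_mem_integralMatrices_iff {k k' : GL (Fin 2) F} (hk : k ∈ maxCompact F)
    (hk' : k' ∈ maxCompact F) (A : Matrix (Fin 2) (Fin 2) F) :
    k.val * A * k'.val ∈ integralMatrices F ↔ A ∈ integralMatrices F := by
  refine ⟨fun h => ?_, fun h => integralMatrices_mul (integralMatrices_mul
    (integralMatrices_of_mem_maxCompact hk) h) (integralMatrices_of_mem_maxCompact hk')⟩
  have h2 := integralMatrices_mul (integralMatrices_mul
    (integralMatrices_of_mem_maxCompact (inv_mem hk)) h)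
    (integralMatrices_of_mem_maxCompact (inv_mem hk'))
  have h3 : (k⁻¹).val * (k.val * A * k'.val) * (k'⁻¹).val = A := by
    rw [Matrix.mul_assoc, Matrix.mul_assoc, Matrix.mul_assoc, Units.mul_inv, Matrix.mul_one,
      ← Matrix.mul_assoc, Units.inv_mul, Matrix.one_mul]
  rwa [h3] at h2

theorem unip_mem_maxCompact_iff (x : F) : unip x ∈ maxCompact F ↔ x ∈ 𝒪[F] := by
  rw [mem_maxCompact_iff]
  constructor
  · intro h
    simpa [unip_val] using h.1 0 1
  · intro h
    refine ⟨fun i j => ?_, by simp [unip_val, Matrix.det_fin_two]⟩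
    fin_cases i <;> fin_cases j <;> simp [unip_val, h, zero_mem, one_mem]

theorem diag_mem_maxCompact {a d : Fˣ} (ha : valuation F (a : F) = 1)
    (hd : valuation F (d : F) = 1) : diag a d ∈ maxCompact F := by
  rw [mem_maxCompact_iff]
  refine ⟨fun i j => ?_, by simp [diag_val, Matrix.det_fin_two, ha, hd]⟩
  fin_cases i <;> fin_cases j <;> simp [diag_val, zero_mem, Valuation.mem_integer_iff, ha, hd]

theorem exists_mem_maxCompact_val_eq {A : Matrix (Fin 2) (Fin 2) F}
    (hA : A ∈ integralMatrices F) (hdet : valuation F A.det = 1) :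
    ∃ k ∈ maxCompact F, k.val = A := by
  have h0 : A.det ≠ 0 := by
    intro h
    simp [h] at hdet
  refine ⟨GeneralLinearGroup.mk'' A h0.isUnit, (mem_maxCompact_iff _).2 ⟨hA, hdet⟩, rfl⟩

/-- The Iwasawa decomposition of `GL₂(F)`. -/
theorem exists_iwasawa (g : GL (Fin 2) F) :
    ∃ (x : F) (a d : Fˣ), ∃ k ∈ maxCompact F, g = unip x * diag a d * k := by
  suffices h : ∃ k ∈ maxCompact F, (g * k).val 1 0 = 0 by
    obtain ⟨k, hk, h⟩ := h
    obtain ⟨x, a, d, h⟩ := upperTriangular_eq h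
    exact ⟨x, a, d, k⁻¹, inv_mem hk, by rw [← h, mul_inv_cancel_right]⟩
  have hdet := det_val_ne_zero g
  rw [Matrix.det_fin_two] at hdet
  -- Dividing by the larger entry of the bottom row gives an integral column operation that kills
  -- the lower left entry.
  rcases le_or_gt (valuation F (g.val 1 0)) (valuation F (g.val 1 1)) with h | h
  · have hd : g.val 1 1 ≠ 0 := by
      intro h0
      rw [h0, map_zero, le_zero_iff, map_eq_zero] at h
      simp [h0, h] at hdet
    have hm : g.val 1 0 / g.val 1 1 ∈ 𝒪[F] := by
      rw [Valuation.mem_integer_iff, map_div₀]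
      exact div_le_one_of_le₀ h zero_le
    obtain ⟨k, hk, hkv⟩ := exists_mem_maxCompact_val_eq
      (A := !![1, 0; -(g.val 1 0 / g.val 1 1), 1])
      (by intro i j; fin_cases i <;> fin_cases j <;> simp [zero_mem, one_mem, hm])
      (by simp [Matrix.det_fin_two])
    refine ⟨k, hk, ?_⟩
    rw [Units.val_mul, hkv, Matrix.mul_apply, Fin.sum_univ_two]
    simp [mul_div_cancel₀ _ hd]
  · have hc : g.val 1 0 ≠ 0 := by
      intro h0
      rw [h0, map_zero] at h
      exact not_lt_zero h
    have hm : g.val 1 1 / g.val 1 0 ∈ 𝒪[F] := by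
      rw [Valuation.mem_integer_iff, map_div₀]
      exact div_le_one_of_le₀ h.le zero_le
    obtain ⟨k, hk, hkv⟩ := exists_mem_maxCompact_val_eq
      (A := !![-(g.val 1 1 / g.val 1 0), 1; 1, 0])
      (by intro i j; fin_cases i <;> fin_cases j <;> simp [zero_mem, one_mem, hm])
      (by simp [Matrix.det_fin_two])
    refine ⟨k, hk, ?_⟩
    rw [Units.val_mul, hkv, Matrix.mul_apply, Fin.sum_univ_two]
    simp [mul_div_cancel₀ _ hc]

end MaxCompact

/-! ### Coset representatives and the Hecke operator. -/

section Hecke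

variable {F : Type*} [Field F] [ValuativeRel F]

/-- A representative in `𝒪` of a residue class. -/
def resLift (b : 𝓀[F]) : 𝒪[F] := Function.surjInv IsLocalRing.residue_surjective b

theorem residue_resLift (b : 𝓀[F]) : IsLocalRing.residue 𝒪[F] (resLift b) = b :=
  Function.surjInv_eq _ b

/-- Representatives of the left cosets of `K` in `K diag(ϖ, 1) K`. -/
def heckeRep (ϖ : Fˣ) : Option 𝓀[F] → GL (Fin 2) F
  | none => diag 1 ϖ
  | some b => unip (resLift b : F) * diag ϖ 1

theorem heckeRep_none_val (ϖ : Fˣ) : (heckeRep ϖ none).val = !![1, 0; 0, (ϖ : F)] := rfl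

theorem heckeRep_some_val (ϖ : Fˣ) (b : 𝓀[F]) :
    (heckeRep ϖ (some b)).val = !![(ϖ : F), (resLift b : F); 0, 1] := by
  ext i j
  fin_cases i <;> fin_cases j <;> simp [heckeRep, unip_val, diag_val]

theorem det_heckeRep (ϖ : Fˣ) (x : Option 𝓀[F]) : (heckeRep ϖ x).val.det = ϖ := by
  cases x <;> simp [heckeRep_none_val, heckeRep_some_val, Matrix.det_fin_two]

theorem heckeRep_val_mem {ϖ : Fˣ} (hϖ : IsUniformizer ϖ) (x : Option 𝓀[F]) :
    (heckeRep ϖ x).val ∈ integralMatrices F := by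
  obtain ⟨h, -⟩ := hϖ
  intro i j
  rcases x with _ | b
  · rw [heckeRep_none_val]
    fin_cases i <;> fin_cases j <;> simp [zero_mem, one_mem, h]
  · rw [heckeRep_some_val]
    fin_cases i <;> fin_cases j <;> simp [zero_mem, one_mem, h]

variable [TopologicalSpace F] [IsNonarchimedeanLocalField F]

theorem residue_eq_zero_iff {ϖ : Fˣ} (hϖ : IsUniformizer ϖ) (a : 𝒪[F]) :
    IsLocalRing.residue 𝒪[F] a = 0 ↔ ∃ c : 𝒪[F], (a : F) = ϖ * c := by
  obtain ⟨h, hirr⟩ := hϖ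
  rw [IsLocalRing.residue_eq_zero_iff, hirr.maximalIdeal_eq, Ideal.mem_span_singleton]
  exact ⟨fun ⟨c, hc⟩ => ⟨c, congrArg Subtype.val hc⟩, fun ⟨c, hc⟩ => ⟨c, Subtype.ext hc⟩⟩

theorem uniformizer_mul_ne_one {ϖ : Fˣ} (hϖ : IsUniformizer ϖ) {x : F} (hx : x ∈ 𝒪[F]) :
    (ϖ : F) * x ≠ 1 := by
  intro h
  have := (residue_eq_zero_iff hϖ 1).2 ⟨⟨x, hx⟩, h.symm⟩
  simp at this

theorem heckeRep_injective {ϖ : Fˣ} (hϖ : IsUniformizer ϖ) {x y : Option 𝓀[F]}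
    {k : GL (Fin 2) F} (hk : k ∈ maxCompact F) (h : heckeRep ϖ x * k = heckeRep ϖ y) : x = y := by
  have hk' := ((mem_maxCompact_iff k).1 hk).1
  have h := congrArg Units.val h
  rw [Units.val_mul] at h
  have h00 := congrFun (congrFun h 0) 0
  have h01 := congrFun (congrFun h 0) 1
  have h10 := congrFun (congrFun h 1) 0
  have h11 := congrFun (congrFun h 1) 1
  rw [Matrix.mul_apply, Fin.sum_univ_two] at h00 h01 h10 h11
  rcases x with _ | b <;> rcases y with _ | c <;>
    simp only [heckeRep_none_val, heckeRep_some_val, Matrix.of_apply, Matrix.cons_val',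
      Matrix.cons_val_zero, Matrix.cons_val_one, Matrix.cons_val_fin_one,
      zero_mul, one_mul, zero_add, add_zero] at h00 h01 h10 h11
  · rfl
  · exact absurd h11 (uniformizer_mul_ne_one hϖ (hk' 1 1))
  · rw [h10, mul_zero, add_zero] at h00
    exact absurd h00 (uniformizer_mul_ne_one hϖ (hk' 0 0))
  · rw [h11, mul_one] at h01
    have := (residue_eq_zero_iff hϖ (resLift c - resLift b)).2
      ⟨⟨_, hk' 0 1⟩, by push_cast; rw [← h01]; ring⟩
    rw [map_sub, residue_resLift, residue_resLift, sub_eq_zero] at this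
    rw [this]

/-- Modulo `ϖ` the matrix is singular, so either its bottom row vanishes or its top row is a
multiple of the bottom one. The multiplier is the residue class that labels the coset. -/
theorem exists_heckeRep_mul {ϖ : Fˣ} (hϖ : IsUniformizer ϖ) {g : GL (Fin 2) F}
    (hg : g.val ∈ integralMatrices F) (hdet : valuation F g.val.det = valuation F (ϖ : F)) :
    ∃ x, ∃ k ∈ maxCompact F, g = heckeRep ϖ x * k := by
  obtain ⟨a, ha⟩ : ∃ a : 𝒪[F], (a : F) = g.val 0 0 := ⟨⟨_, hg 0 0⟩, rfl⟩
  obtain ⟨b, hb⟩ : ∃ a : 𝒪[F], (a : F) = g.val 0 1 := ⟨⟨_, hg 0 1⟩, rfl⟩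
  obtain ⟨c, hc⟩ : ∃ a : 𝒪[F], (a : F) = g.val 1 0 := ⟨⟨_, hg 1 0⟩, rfl⟩
  obtain ⟨d, hd⟩ : ∃ a : 𝒪[F], (a : F) = g.val 1 1 := ⟨⟨_, hg 1 1⟩, rfl⟩
  have hϖ0 : valuation F (ϖ : F) ≠ 0 := by simp
  -- An integral cofactor is automatically in `K`, by comparing determinants.
  suffices h : ∃ x, ∃ A ∈ integralMatrices F, g.val = (heckeRep ϖ x).val * A by
    obtain ⟨x, A, hA, h⟩ := h
    rw [h, Matrix.det_mul, det_heckeRep, map_mul] at hdet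
    obtain ⟨k, hk, hkA⟩ := exists_mem_maxCompact_val_eq hA (mul_eq_left₀ hϖ0 |>.1 hdet)
    exact ⟨x, k, hk, Units.ext (by rw [h, Units.val_mul, hkA])⟩
  have hdet0 : IsLocalRing.residue 𝒪[F] (a * d - b * c) = 0 := by
    rw [residue_eq_zero_iff hϖ]
    refine ⟨⟨g.val.det / ϖ, ?_⟩, ?_⟩
    · rw [Valuation.mem_integer_iff, map_div₀, hdet, div_self hϖ0]
    · simp [Matrix.det_fin_two, ha, hb, hc, hd, mul_div_cancel₀]
  rw [map_sub, map_mul, map_mul, sub_eq_zero] at hdet0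
  have key : ∀ y : 𝓀[F], IsLocalRing.residue 𝒪[F] a = y * IsLocalRing.residue 𝒪[F] c →
      IsLocalRing.residue 𝒪[F] b = y * IsLocalRing.residue 𝒪[F] d →
      ∃ x, ∃ A ∈ integralMatrices F, g.val = (heckeRep ϖ x).val * A := by
    intro y h1 h2
    obtain ⟨a', ha'⟩ := (residue_eq_zero_iff hϖ (a - resLift y * c)).1
      (by rw [map_sub, map_mul, residue_resLift, h1, sub_self])
    obtain ⟨b', hb'⟩ := (residue_eq_zero_iff hϖ (b - resLift y * d)).1
      (by rw [map_sub, map_mul, residue_resLift, h2, sub_self])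
    push_cast at ha' hb'
    refine ⟨some y, !![(a' : F), b'; c, d], ?_, ?_⟩
    · intro i j
      fin_cases i <;> fin_cases j
      exacts [a'.2, b'.2, c.2, d.2]
    · rw [heckeRep_some_val]
      ext i j
      fin_cases i <;> fin_cases j <;> simp [← ha', ← hb', ← ha, ← hb, ← hc, ← hd]
  by_cases hd0 : IsLocalRing.residue 𝒪[F] d = 0
  · by_cases hc0 : IsLocalRing.residue 𝒪[F] c = 0
    · obtain ⟨c', hc'⟩ := (residue_eq_zero_iff hϖ c).1 hc0
      obtain ⟨d', hd'⟩ := (residue_eq_zero_iff hϖ d).1 hd0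
      refine ⟨none, !![(a : F), b; c', d'], ?_, ?_⟩
      · intro i j
        fin_cases i <;> fin_cases j
        exacts [a.2, b.2, c'.2, d'.2]
      · rw [heckeRep_none_val]
        ext i j
        fin_cases i <;> fin_cases j <;> simp [← hc', ← hd', ← ha, ← hb, ← hc, ← hd]
    · refine key (IsLocalRing.residue 𝒪[F] a / IsLocalRing.residue 𝒪[F] c)
        (div_mul_cancel₀ _ hc0).symm ?_
      rw [div_mul_eq_mul_div, eq_div_iff hc0, hdet0]
  · refine key (IsLocalRing.residue 𝒪[F] b / IsLocalRing.residue 𝒪[F] d) ?_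
      (div_mul_cancel₀ _ hd0).symm
    rw [div_mul_eq_mul_div, eq_div_iff hd0, hdet0]

variable [Fintype 𝓀[F]] {V : Type*} [AddCommGroup V] [Module ℂ V]

/-- The Hecke operator of `K diag(ϖ, 1) K` on `K`-fixed vectors. -/
def hecke (π : Representation ℂ (GL (Fin 2) F) V) (ϖ : Fˣ) (v : V) : V :=
  ∑ x, π (heckeRep ϖ x) v

/-- Left multiplication by `k` permutes the left cosets of `K` in the double coset. -/
theorem hecke_fixed (π : Representation ℂ (GL (Fin 2) F) V) {ϖ : Fˣ} (hϖ : IsUniformizer ϖ)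
    {v : V} (hv : ∀ k ∈ maxCompact F, π k v = v) {k : GL (Fin 2) F} (hk : k ∈ maxCompact F) :
    π k (hecke π ϖ v) = hecke π ϖ v := by
  have h : ∀ x, ∃ y, ∃ k' ∈ maxCompact F, k * heckeRep ϖ x = heckeRep ϖ y * k' := by
    intro x
    refine exists_heckeRep_mul hϖ (integralMatrices_mul (integralMatrices_of_mem_maxCompact hk)
      (heckeRep_val_mem hϖ x)) ?_
    rw [Units.val_mul, Matrix.det_mul, map_mul, ((mem_maxCompact_iff k).1 hk).2, one_mul,
      det_heckeRep]
  choose σ k' hk' hσ using h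
  have hinj : Function.Injective σ := by
    intro x y hxy
    refine heckeRep_injective hϖ (mul_mem (inv_mem (hk' x)) (hk' y)) ?_
    have hx := hσ x
    have hy := hσ y
    rw [← hxy] at hy
    rw [← mul_right_inj k, ← mul_assoc, hx, hy]
    group
  rw [hecke, map_sum]
  refine Fintype.sum_bijective σ (Finite.injective_iff_bijective.1 hinj) _ _ fun x => ?_
  rw [← Module.End.mul_apply, ← map_mul, hσ, map_mul, Module.End.mul_apply, hv _ (hk' x)]

end Hecke

/-! ### `K`-fixed vectors and Hecke eigenvalues in the induced representation and its constituents.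
-/

section Spherical

variable {F : Type*} [Field F] [ValuativeRel F] [TopologicalSpace F]
  [IsNonarchimedeanLocalField F]

instance t2Space : T2Space F := by
  let := IsTopologicalAddGroup.rightUniformSpace F
  have := isUniformAddGroup_of_addCommGroup (G := F)
  infer_instance

instance compactSpace_maxCompact : CompactSpace (maxCompact F) := by
  have : CompactSpace (Matrix (Fin 2) (Fin 2) 𝒪[F]) :=
    inferInstanceAs (CompactSpace (Fin 2 → Fin 2 → 𝒪[F]))
  have : T1Space (Matrix (Fin 2) (Fin 2) 𝒪[F]) :=
    inferInstanceAs (T1Space (Fin 2 → Fin 2 → 𝒪[F]))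
  have : CompactSpace (GL (Fin 2) 𝒪[F]) :=
    inferInstanceAs (CompactSpace (Matrix (Fin 2) (Fin 2) 𝒪[F])ˣ)
  have hc : Continuous (GeneralLinearGroup.map (n := Fin 2) (𝒪[F]).subtype) :=
    Continuous.generalLinearGroup_map continuous_subtype_val
  exact isCompact_iff_compactSpace.1 (isCompact_range hc)

section Lift

variable {V E : Type*} [AddCommGroup V] [Module ℂ V] [AddCommGroup E] [Module ℂ E]

/-- A `K`-fixed vector of a quotient of a smooth representation lifts to a `K`-fixed vector. -/
theorem exists_fixed_lift {ρ : Representation ℂ (GL (Fin 2) F) E}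
    {π : Representation ℂ (GL (Fin 2) F) V} (hρ : IsSmooth ρ)
    (p : Representation.IntertwiningMap ρ π) (hp : Function.Surjective p) {v : V}
    (hv : ∀ k ∈ maxCompact F, π k v = v) :
    ∃ w : E, (∀ k ∈ maxCompact F, ρ k w = w) ∧ p w = v := by
  obtain ⟨n, rfl⟩ := hp v
  obtain ⟨U, hU, hUn⟩ := hρ n
  -- An open subgroup of a compact group has finite index, so averaging over `K` is a finite sum
  -- over the cosets of `S`.
  let S : Subgroup (maxCompact F) := U.subgroupOf (maxCompact F)
  have hS : IsOpen (S : Set (maxCompact F)) := hU.preimage continuous_subtype_val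
  have : Finite (maxCompact F ⧸ S) := Subgroup.quotient_finite_of_isOpen S hS
  let := Fintype.ofFinite (maxCompact F ⧸ S)
  have hfix : ∀ (k k' : maxCompact F),
      (QuotientGroup.mk k : maxCompact F ⧸ S) = QuotientGroup.mk k' →
      ρ (k : GL (Fin 2) F) n = ρ (k' : GL (Fin 2) F) n := by
    intro k k' h
    have h1 : k⁻¹ * k' ∈ S := QuotientGroup.eq.1 h
    rw [Subgroup.mem_subgroupOf] at h1
    have h2 : (k' : GL (Fin 2) F) = k * ((k⁻¹ * k' : maxCompact F) : GL (Fin 2) F) := by simp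
    rw [h2, map_mul, Module.End.mul_apply, hUn _ h1]
  let w : E := ∑ c : maxCompact F ⧸ S, ρ (c.out : GL (Fin 2) F) n
  have hw : ∀ k ∈ maxCompact F, ρ k w = w := by
    intro k hk
    simp only [w, map_sum]
    refine Fintype.sum_bijective _ (MulAction.bijective (⟨k, hk⟩ : maxCompact F)) _ _ fun c => ?_
    rw [← Module.End.mul_apply, ← map_mul]
    refine hfix (⟨k, hk⟩ * c.out) _ ?_
    rw [QuotientGroup.out_eq']
    conv_rhs => rw [← QuotientGroup.out_eq' c]
    rfl
  have hpw : p w = (Fintype.card (maxCompact F ⧸ S) : ℂ) • p n := by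
    simp only [w, map_sum]
    rw [Finset.sum_congr rfl fun c _ => (p.isIntertwining _ _ _ _).trans (hv _ c.out.2)]
    simp [Nat.cast_smul_eq_nsmul]
  have hne : (Fintype.card (maxCompact F ⧸ S) : ℂ) ≠ 0 := by
    exact_mod_cast Fintype.card_ne_zero
  refine ⟨(Fintype.card (maxCompact F ⧸ S) : ℂ)⁻¹ • w, fun k hk => ?_, ?_⟩
  · rw [map_smul, hw k hk]
  · rw [map_smul, hpw, inv_smul_smul₀ hne]

end Lift

theorem smooth_subrepresentation_ind {χ χ' : Fˣ →* ℂˣ} (N : Subrepresentation (ind χ χ')) :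
    IsSmooth (V := N.toSubmodule) N.toRepresentation := by
  rintro ⟨⟨φ, h, U, hU, hφ⟩, hN⟩
  refine ⟨U, hU, fun u hu => ?_⟩
  apply Subtype.ext
  apply Subtype.ext
  funext g
  exact hφ u hu g

/-- A `K`-fixed vector of `Ind(χ ⊗ χ')` is determined by its value at `1`. -/
theorem indSpace_fixed_ext {χ χ' : Fˣ →* ℂˣ} {φ φ' : indSpace χ χ'}
    (hφ : ∀ k ∈ maxCompact F, ind χ χ' k φ = φ) (hφ' : ∀ k ∈ maxCompact F, ind χ χ' k φ' = φ')
    (h : φ.1 1 = φ'.1 1) : φ = φ' := by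
  apply Subtype.ext
  funext g
  obtain ⟨x, a, d, k, hk, rfl⟩ := exists_iwasawa g
  have h1 := congrFun (congrArg Subtype.val (hφ k hk)) (unip x * diag a d * 1)
  have h2 := congrFun (congrArg Subtype.val (hφ' k hk)) (unip x * diag a d * 1)
  change φ.1 (unip x * diag a d * 1 * k) = _ at h1
  change φ'.1 (unip x * diag a d * 1 * k) = _ at h2
  rw [φ.2.1] at h1
  rw [φ'.2.1] at h2
  rw [mul_one] at h1 h2
  rw [h1, h2, h]

theorem nabsPow_uniformizer {ϖ : Fˣ} (hϖ : IsUniformizer ϖ) (s : ℂ) :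
    nabsPow ϖ s = (resCard F : ℂ) ^ (-s) := by
  rw [nabsPow_eq, ord_uniformizer hϖ, zpow_one]

theorem resCard_cpow_half_mul_self :
    (resCard F : ℂ) ^ (1 / 2 : ℂ) * (resCard F : ℂ) ^ (1 / 2 : ℂ) = resCard F := by
  have hq' : (resCard F : ℂ) ≠ 0 := by
    exact_mod_cast (zero_lt_one.trans (one_lt_resCard (F := F))).ne'
  rw [← Complex.cpow_add _ _ hq']
  norm_num

/-- It suffices to compare values at `1`. There each of the `q` cosets `some b` contributes `χ(ϖ)
q^{-1/2}`, and the coset `none` contributes `χ'(ϖ) q^{1/2}`. -/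
theorem hecke_ind [Fintype 𝓀[F]] {χ χ' : Fˣ →* ℂˣ} {ϖ : Fˣ} (hϖ : IsUniformizer ϖ)
    {φ : indSpace χ χ'} (hφ : ∀ k ∈ maxCompact F, ind χ χ' k φ = φ) :
    hecke (ind χ χ') ϖ φ =
      ((resCard F : ℂ) ^ (1 / 2 : ℂ) * ((χ ϖ : ℂ) + (χ' ϖ : ℂ))) • φ := by
  refine indSpace_fixed_ext (fun k hk => hecke_fixed _ hϖ hφ hk) (fun k hk => ?_) ?_
  · rw [map_smul, hφ k hk]
  have hval : ∀ x, ((ind χ χ' (heckeRep ϖ x) φ).1 : GL (Fin 2) F → ℂ) 1 =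
      φ.1 (heckeRep ϖ x) := fun x => congrArg φ.1 (one_mul _)
  have hsome : ∀ b : 𝓀[F], φ.1 (heckeRep ϖ (some b)) =
      (χ ϖ : ℂ) * (resCard F : ℂ) ^ (-(1 / 2) : ℂ) * φ.1 1 := by
    intro b
    have := φ.2.1 (resLift b : F) ϖ 1 1
    rw [mul_one, div_one, nabsPow_uniformizer hϖ] at this
    simpa [heckeRep] using this
  have hnone : φ.1 (heckeRep ϖ none) = (χ' ϖ : ℂ) * (resCard F : ℂ) ^ (1 / 2 : ℂ) * φ.1 1 := by
    have := φ.2.1 0 1 ϖ 1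
    rw [mul_one, one_div, nabsPow_eq, ord_inv, ord_uniformizer hϖ, unip_zero, one_mul] at this
    rw [heckeRep, this, _root_.zpow_neg, zpow_one, Complex.cpow_neg, inv_inv]
    simp
  have hsum : (hecke (ind χ χ') ϖ φ).1 1 = ∑ x, φ.1 (heckeRep ϖ x) := by
    rw [hecke, AddSubmonoidClass.coe_finsetSum, Finset.sum_apply]
    exact Finset.sum_congr rfl fun x _ => hval x
  have hcard : (Fintype.card 𝓀[F] : ℂ) = resCard F := by
    rw [resCard, Nat.card_eq_fintype_card]
  have hq0 : (resCard F : ℂ) ^ (1 / 2 : ℂ) ≠ 0 := by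
    intro h0
    have := resCard_cpow_half_mul_self (F := F)
    rw [h0, zero_mul] at this
    exact (zero_lt_one.trans (one_lt_resCard (F := F))).ne (by exact_mod_cast this)
  rw [hsum, Fintype.sum_option, hnone, Finset.sum_congr rfl fun b _ => hsome b, Finset.sum_const,
    Finset.card_univ, nsmul_eq_mul, hcard, Complex.cpow_neg]
  change _ = _ * φ.1 1
  have hq := resCard_cpow_half_mul_self (F := F)
  have hq1 : (resCard F : ℂ) * ((resCard F : ℂ) ^ (1 / 2 : ℂ))⁻¹ =
      (resCard F : ℂ) ^ (1 / 2 : ℂ) := by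
    rw [← div_eq_mul_inv, div_eq_iff hq0, hq]
  linear_combination (χ ϖ : ℂ) * φ.1 1 * hq1

theorem ind_scalar {χ χ' : Fˣ →* ℂˣ} (z : Fˣ) (φ : indSpace χ χ') :
    ind χ χ' (GeneralLinearGroup.scalar (Fin 2) z) φ = ((χ z : ℂ) * (χ' z : ℂ)) • φ := by
  apply Subtype.ext
  funext g
  have hc : g * GeneralLinearGroup.scalar (Fin 2) z =
      GeneralLinearGroup.scalar (Fin 2) z * g := by
    ext i j
    simp [mul_comm]
  have := φ.2.1 0 z z g
  rw [unip_zero, one_mul, div_self', nabsPow_eq, ord_one, zpow_zero, mul_one, ← scalar_eq_diag,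
    ← hc] at this
  exact this

variable {V : Type*} [AddCommGroup V] [Module ℂ V]

/-- Scalars act on the whole induced representation through `χχ'`, hence on every nonzero
subquotient. -/
theorem centralChar_apply {π : Representation ℂ (GL (Fin 2) F) V} {χ χ' ω : Fˣ →* ℂˣ}
    (h : IsConstituentOfInd π χ χ') (hω : IsCentralChar π ω) [Nontrivial V] (z : Fˣ) :
    (ω z : ℂ) = (χ z : ℂ) * (χ' z : ℂ) := by
  obtain ⟨N, p, hp⟩ := h
  obtain ⟨v, hv⟩ := exists_ne (0 : V)
  obtain ⟨n, rfl⟩ := hp v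
  have h1 := hω z (p n)
  rw [← p.isIntertwining] at h1
  have h2 : N.toRepresentation (GeneralLinearGroup.scalar (Fin 2) z) n =
      ((χ z : ℂ) * (χ' z : ℂ)) • n := Subtype.ext (ind_scalar z n.1)
  rw [h2, map_smul] at h1
  exact (smul_left_injective ℂ hv h1).symm

theorem hecke_constituent [Fintype 𝓀[F]] {π : Representation ℂ (GL (Fin 2) F) V}
    {χ χ' : Fˣ →* ℂˣ} (h : IsConstituentOfInd π χ χ') {ϖ : Fˣ} (hϖ : IsUniformizer ϖ) {v : V}
    (hv : ∀ k ∈ maxCompact F, π k v = v) :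
    hecke π ϖ v = ((resCard F : ℂ) ^ (1 / 2 : ℂ) * ((χ ϖ : ℂ) + (χ' ϖ : ℂ))) • v := by
  obtain ⟨N, p, hp⟩ := h
  obtain ⟨n, hn, rfl⟩ := exists_fixed_lift (smooth_subrepresentation_ind N) p hp hv
  have h1 := hecke_ind hϖ (φ := n.1) fun k hk => congrArg Subtype.val (hn k hk)
  have h2 : hecke (V := N.toSubmodule) N.toRepresentation ϖ n =
      ((resCard F : ℂ) ^ (1 / 2 : ℂ) * ((χ ϖ : ℂ) + (χ' ϖ : ℂ))) • n := by
    apply Subtype.ext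
    rw [hecke, AddSubmonoidClass.coe_finsetSum]
    exact h1
  rw [← map_smul, ← h2, hecke, hecke, map_sum]
  exact Finset.sum_congr rfl fun x _ => (p.isIntertwining _ _ _ _).symm

end Spherical

/-! ### From invariant matrix coefficients to fixed vectors. -/

section Whittaker

variable {F : Type*} [Field F] {V : Type*} [AddCommGroup V] [Module ℂ V]

/-- A vector of an irreducible representation whose matrix coefficient against a nonzero functional
is right invariant under `H` is fixed by `H`. -/
theorem fixed_of_coefficient_invariant {π : Representation ℂ (GL (Fin 2) F) V}
    (hπ : π.IsIrreducible) {l : V →ₗ[ℂ] ℂ} (hl : l ≠ 0) {v : V} {H : Subgroup (GL (Fin 2) F)}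
    (hv : ∀ g, ∀ k ∈ H, l (π (g * k) v) = l (π g v)) : ∀ k ∈ H, π k v = v := by
  -- Vectors all of whose coefficients against `l` vanish form a subrepresentation; it is proper
  -- because `l ≠ 0`, hence zero.
  let S : Subrepresentation π :=
    { toSubmodule :=
        { carrier := {w | ∀ g, l (π g w) = 0}
          add_mem' := fun ha hb g => by rw [map_add, map_add, ha g, hb g, add_zero]
          zero_mem' := fun g => by rw [map_zero, map_zero]
          smul_mem' := fun c w hw g => by rw [map_smul, map_smul, hw g, smul_zero] }
      apply_mem_toSubmodule := fun h w hw g => by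
        rw [← Module.End.mul_apply, ← map_mul]
        exact hw (g * h) }
  have hbot : S = ⊥ := by
    refine (eq_bot_or_eq_top S).resolve_right fun h => hl ?_
    ext w
    have hw : w ∈ S := by
      rw [h]
      exact Submodule.mem_top (R := ℂ)
    have hw : ∀ g, l (π g w) = 0 := hw
    simpa using hw 1
  intro k hk
  have hmem : π k v - v ∈ S := by
    intro g
    rw [map_sub, map_sub, ← Module.End.mul_apply, ← map_mul, hv g k hk, sub_self]
  rw [hbot] at hmem
  exact sub_eq_zero.1 ((Submodule.mem_bot ℂ).1 hmem)

end Whittaker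

/-! ### Values of the spherical Whittaker function on the torus. -/

section Values

/-- The complete homogeneous symmetric polynomial of degree `n` in two variables. -/
def completeSymm (X Y : ℂ) (n : ℕ) : ℂ :=
  ∑ p ∈ Finset.HasAntidiagonal.antidiagonal n, X ^ p.1 * Y ^ p.2

theorem completeSymm_zero (X Y : ℂ) : completeSymm X Y 0 = 1 := by
  simp [completeSymm]

theorem completeSymm_succ (X Y : ℂ) (n : ℕ) :
    completeSymm X Y (n + 1) = Y ^ (n + 1) + X * completeSymm X Y n := by
  rw [completeSymm, Finset.Nat.sum_antidiagonal_succ, completeSymm, Finset.mul_sum]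
  simp only [pow_zero, one_mul, pow_succ]
  congr 1
  exact Finset.sum_congr rfl fun p _ => by ring

theorem completeSymm_add_two (X Y : ℂ) (n : ℕ) :
    completeSymm X Y (n + 2) =
      (X + Y) * completeSymm X Y (n + 1) - X * Y * completeSymm X Y n := by
  rw [completeSymm_succ X Y (n + 1)]
  linear_combination (-Y) * completeSymm_succ X Y n

theorem completeSymm_mul_pow (X Y t : ℂ) (n : ℕ) :
    completeSymm X Y n * t ^ n = completeSymm (X * t) (Y * t) n := by
  rw [completeSymm, completeSymm, Finset.sum_mul]
  refine Finset.sum_congr rfl fun p hp => ?_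
  rw [← Finset.HasAntidiagonal.mem_antidiagonal.1 hp, pow_add, mul_pow, mul_pow]
  ring

variable {F : Type*} [Field F] [ValuativeRel F] [TopologicalSpace F]
  [IsNonarchimedeanLocalField F]

/-- The properties of the normalized spherical Whittaker function that determine its values: the
transformation laws and the eigenvalue equation under the Hecke operator. -/
structure IsSphericalWhittaker [Fintype 𝓀[F]] (ψ : AddChar F Circle) (ϖ : Fˣ) (X Y : ℂ)
    (W : GL (Fin 2) F → ℂ) : Prop where
  unip_mul : ∀ x g, W (unip x * g) = (ψ x : ℂ) * W g
  mul_maxCompact : ∀ g, ∀ k ∈ maxCompact F, W (g * k) = W g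
  map_one : W 1 = 1
  scalar_mul : ∀ g, W (g * GeneralLinearGroup.scalar (Fin 2) ϖ) = X * Y * W g
  hecke : ∀ g, ∑ x, W (g * heckeRep ϖ x) = (resCard F : ℂ) ^ (1 / 2 : ℂ) * (X + Y) * W g

theorem isSphericalWhittaker [Fintype 𝓀[F]] {V : Type*} [AddCommGroup V] [Module ℂ V]
    {π : Representation ℂ (GL (Fin 2) F) V} (hπ : IsSpherical π) {χ χ' ω : Fˣ →* ℂˣ}
    (hχ : IsSatake π χ χ') (hω : IsCentralChar π ω) {ψ : AddChar F Circle}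
    {W : GL (Fin 2) F → ℂ} (hW : W ∈ whittakerModel π ψ) (hK : IsNormalizedSpherical W)
    {ϖ : Fˣ} (hϖ : IsUniformizer ϖ) :
    IsSphericalWhittaker ψ ϖ (χ ϖ) (χ' ϖ) W := by
  obtain ⟨l, hl, hψ, v, rfl⟩ := hW
  obtain ⟨hK, h1⟩ := hK
  have hv := fixed_of_coefficient_invariant hπ.irreducible hl hK
  have : Nontrivial V := by
    obtain ⟨v, hv, -⟩ := hπ.exists_fixed
    exact ⟨v, 0, hv⟩
  refine ⟨fun x g => ?_, hK, h1, fun g => ?_, fun g => ?_⟩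
  · simp only [map_mul, Module.End.mul_apply]
    exact hψ x _
  · simp only [map_mul, Module.End.mul_apply]
    rw [hω, map_smul, map_smul, centralChar_apply hχ.constituent hω, smul_eq_mul]
  · have := congrArg (fun w => l (π g w)) (hecke_constituent hχ.constituent hϖ hv)
    simp only [LocalGL2.hecke, map_sum, map_smul, smul_eq_mul] at this
    simp only [map_mul, Module.End.mul_apply]
    exact this

namespace IsSphericalWhittaker

variable [Fintype 𝓀[F]] {ψ : AddChar F Circle} {ϖ : Fˣ} {X Y : ℂ} {W : GL (Fin 2) F → ℂ}

/-- Moving an integral unipotent from right to left gives `W = ψ(αx) W` at `diag(α, 1)`, and some `x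
∈ 𝒪` has `ψ(αx) ≠ 1`. -/
theorem diag_eq_zero (hW : IsSphericalWhittaker ψ ϖ X Y W) (hψ : IsUnramifiedAddChar ψ)
    {α : Fˣ} (hα : (α : F) ∉ 𝒪[F]) : W (diag α 1) = 0 := by
  have h := mt (hψ α).1 hα
  push Not at h
  obtain ⟨x, hx, hne⟩ := h
  have h1 := hW.mul_maxCompact (diag α 1) _ ((unip_mem_maxCompact_iff x).2 hx)
  rw [diag_mul_unip, hW.unip_mul] at h1
  by_contra h0
  exact hne (Circle.ext (by simpa using (mul_eq_right₀ h0).1 h1))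

/-- For integral `α` the `q` unipotent cosets contribute equally, as `ψ` is trivial on `α𝒪`. The
remaining one is `diag(1, ϖ) = ϖ · diag(ϖ⁻¹, 1)`, whose scalar part gives `XY`. -/
theorem hecke_diag (hW : IsSphericalWhittaker ψ ϖ X Y W) (hψ : IsUnramifiedAddChar ψ)
    {α : Fˣ} (hα : (α : F) ∈ 𝒪[F]) :
    (resCard F : ℂ) * W (diag (α * ϖ) 1) + X * Y * W (diag (α * ϖ⁻¹) 1) =
      (resCard F : ℂ) ^ (1 / 2 : ℂ) * (X + Y) * W (diag α 1) := by
  rw [← hW.hecke, Fintype.sum_option, ← hW.scalar_mul]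
  have h1 : diag (α * ϖ⁻¹) 1 * GeneralLinearGroup.scalar (Fin 2) ϖ =
      diag α 1 * heckeRep ϖ none := by
    rw [scalar_eq_diag, heckeRep, diag_mul, diag_mul]
    simp
  have h2 : ∀ b : 𝓀[F], W (diag α 1 * heckeRep ϖ (some b)) = W (diag (α * ϖ) 1) := by
    intro b
    rw [heckeRep, ← mul_assoc, diag_mul_unip, mul_assoc, hW.unip_mul, diag_mul, mul_one,
      (hψ α).2 hα _ (resLift b).2]
    simp
  rw [h1, Finset.sum_congr rfl fun b _ => h2 b, Finset.sum_const, Finset.card_univ, nsmul_eq_mul,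
    resCard, Nat.card_eq_fintype_card, add_comm]

theorem diag_pow (hW : IsSphericalWhittaker ψ ϖ X Y W) (hψ : IsUnramifiedAddChar ψ)
    (hϖ : IsUniformizer ϖ) (n : ℕ) :
    ((resCard F : ℂ) ^ (1 / 2 : ℂ)) ^ n * W (diag (ϖ ^ n) 1) = completeSymm X Y n := by
  have hR := resCard_cpow_half_mul_self (F := F)
  have hR0 : (resCard F : ℂ) ^ (1 / 2 : ℂ) ≠ 0 := by
    intro h0
    rw [h0, zero_mul] at hR
    exact (zero_lt_one.trans (one_lt_resCard (F := F))).ne (by exact_mod_cast hR)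
  set R := (resCard F : ℂ) ^ (1 / 2 : ℂ)
  induction n using Nat.twoStepInduction with
  | zero => simp [diag_one, hW.map_one, completeSymm_zero]
  | one =>
    have h := hW.hecke_diag hψ (α := 1) (one_mem _)
    -- Vanishing at `ϖ⁻¹` supplies the second initial value of the recurrence.
    rw [hW.diag_eq_zero hψ (α := 1 * ϖ⁻¹), diag_one, hW.map_one] at h
    · rw [completeSymm_succ, completeSymm_zero, pow_one, pow_one]
      apply mul_left_cancel₀ hR0
      rw [one_mul] at h
      linear_combination h + W (diag ϖ 1) * hR
    · intro hmem
      refine uniformizer_mul_ne_one hϖ hmem ?_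
      simp
  | more n h1 h2 =>
    have hmem : ((ϖ ^ (n + 1) : Fˣ) : F) ∈ 𝒪[F] := by
      rw [Units.val_pow_eq_pow_val]
      exact pow_mem hϖ.1 _
    have h := hW.hecke_diag hψ hmem
    rw [← pow_succ, pow_succ ϖ n, mul_inv_cancel_right, ← pow_succ] at h
    rw [completeSymm_add_two, ← h1, ← h2, pow_succ, pow_succ]
    linear_combination R ^ n * h + R ^ n * W (diag (ϖ ^ (n + 2)) 1) * hR

theorem diag_eq (hW : IsSphericalWhittaker ψ ϖ X Y W) (hψ : IsUnramifiedAddChar ψ)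
    (hϖ : IsUniformizer ϖ) {α : Fˣ} {n : ℕ} (hα : ord α = n) :
    ((resCard F : ℂ) ^ (1 / 2 : ℂ)) ^ n * W (diag α 1) = completeSymm X Y n := by
  rw [← hW.diag_pow hψ hϖ n, ← hW.mul_maxCompact (diag (ϖ ^ n) 1) (diag ((ϖ ^ n)⁻¹ * α) 1)]
  · rw [diag_mul, mul_inv_cancel_left, mul_one]
  · refine diag_mem_maxCompact ?_ (by simp)
    rw [valuation_eq_one_iff, ord_mul, ord_inv, ← zpow_natCast, ord_zpow, ord_uniformizer hϖ, hα]
    ring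

end IsSphericalWhittaker

end Values

/-! ### Topology and Haar measure on `F` and `Fˣ`. -/

section Measures

variable {F : Type*} [Field F] [ValuativeRel F] [TopologicalSpace F]
  [IsNonarchimedeanLocalField F]

theorem continuous_ord : Continuous (ord : Fˣ → ℤ) := by
  rw [continuous_discrete_rng]
  intro n
  by_cases h : ∃ x : Fˣ, ord x = n
  · obtain ⟨x, rfl⟩ := h
    have hx : (valuation F).restrict (x : F) ≠ 0 := by
      rw [← map_zero (valuation F).restrict, ne_eq, (valuation F).restrict_inj]
      simp
    have ho := (Valuation.isOpen_sphere (v := valuation F) hx).preimage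
      (Units.continuous_val (M := F))
    convert ho using 1
    ext y
    simp only [Set.mem_preimage, Set.mem_singleton_iff, Set.mem_ofPred_eq,
      (valuation F).restrict_inj]
    rw [le_antisymm_iff, le_antisymm_iff, valuation_le_valuation_iff, valuation_le_valuation_iff,
      and_comm]
  · convert isOpen_empty
    ext y
    simpa using fun hy => h ⟨y, hy⟩

theorem sigmaCompactSpace {ϖ : Fˣ} (hϖ : IsUniformizer ϖ) : SigmaCompactSpace F := by
  refine SigmaCompactSpace.of_countable
    (Set.range fun n : ℕ => {x : F | valuation F x ≤ valuation F ((ϖ ^ (-n : ℤ) : Fˣ) : F)})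
    (Set.countable_range _) ?_ ?_
  · rintro _ ⟨n, rfl⟩
    exact IsNonarchimedeanLocalField.isCompact_closedBall F _
  · refine Set.eq_univ_of_forall fun x => ?_
    rw [Set.sUnion_range, Set.mem_iUnion]
    rcases eq_or_ne x 0 with rfl | hx
    · exact ⟨0, by simp⟩
    · obtain ⟨y, rfl⟩ : ∃ y : Fˣ, (y : F) = x := ⟨Units.mk0 x hx, rfl⟩
      refine ⟨(ord y).natAbs, ?_⟩
      rw [Set.mem_ofPred_eq, valuation_le_valuation_iff, ord_zpow, ord_uniformizer hϖ]
      omega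

theorem continuous_of_isUnramifiedAddChar {ψ : AddChar F Circle} (hψ : IsUnramifiedAddChar ψ) :
    Continuous ψ := by
  rw [continuous_iff_continuousAt]
  intro x
  have hmem : {y : F | y - x ∈ 𝒪[F]} ∈ nhds x := by
    have ho : IsOpen {y : F | y - x ∈ 𝒪[F]} :=
      (Valuation.isOpen_integer (v := valuation F)).preimage (continuous_sub_right x)
    exact ho.mem_nhds (by simp [zero_mem])
  refine (continuousAt_const (y := ψ x)).congr (Filter.eventually_of_mem hmem fun y hy => ?_)
  have h1 := (hψ 1).2 (one_mem _) _ hy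
  rw [one_mul, AddChar.map_sub_eq_div, div_eq_one] at h1
  exact h1.symm

variable [MeasurableSpace F] [BorelSpace F]

instance borelSpace_units : BorelSpace Fˣ := by
  refine ⟨?_⟩
  rw [Units.isEmbedding_val₀.eq_induced, borel_comap, ← BorelSpace.measurable_eq (α := F)]
  rfl

/-- The fibre of `ord` over `n` is `ϖⁿ𝒪ˣ`, a translate of a set of volume one. Integrals of
functions of `ord` thus become sums over `ℤ`. -/
theorem map_ord_eq_count (dt : Measure Fˣ) [dt.IsHaarMeasure]
    (hdt : dt {x : Fˣ | valuation F (x : F) = 1} = 1) {ϖ : Fˣ} (hϖ : IsUniformizer ϖ) :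
    dt.map ord = Measure.count := by
  refine Measure.ext_of_singleton fun n => ?_
  rw [Measure.map_apply continuous_ord.measurable (measurableSet_singleton n),
    Measure.count_singleton, ← hdt, ← measure_preimage_mul dt (ϖ ^ n)]
  congr 1
  ext x
  simp only [Set.mem_preimage, Set.mem_singleton_iff, Set.mem_ofPred_eq, valuation_eq_one_iff,
    ord_mul, ord_zpow, ord_uniformizer hϖ]
  omega

theorem integrable_comp_ord {dt : Measure Fˣ} (h : dt.map ord = Measure.count) {f : ℤ → ℂ}
    (hf : Summable fun n => ‖f n‖) : Integrable (fun x => f (ord x)) dt := by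
  have : Integrable f (dt.map ord) := by rwa [h, integrable_count_iff]
  exact this.comp_measurable continuous_ord.measurable

theorem integral_comp_ord {dt : Measure Fˣ} (h : dt.map ord = Measure.count) {f : ℤ → ℂ}
    (hf : Summable fun n => ‖f n‖) : ∫ x, f (ord x) ∂dt = ∑' n, f n := by
  have hi : Integrable f Measure.count := integrable_count_iff.2 hf
  rw [← integral_map continuous_ord.aemeasurable (by rw [h]; exact hi.1), h,
    integral_countable hi]
  simp

end Measures

/-! ### The inner integrals as `L`-factors. -/

section Inner

/-- The coefficients of the power series of an unramified `L`-factor of degree two, extended by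
zero to negative degrees. -/
def lCoeff (X Y : ℂ) : ℤ → ℂ
  | .ofNat n => completeSymm X Y n
  | .negSucc _ => 0

theorem lCoeff_natCast (X Y : ℂ) (n : ℕ) : lCoeff X Y n = completeSymm X Y n := rfl

theorem lCoeff_of_neg (X Y : ℂ) {n : ℤ} (hn : n < 0) : lCoeff X Y n = 0 := by
  obtain ⟨m, rfl⟩ := Int.eq_negSucc_of_lt_zero hn
  rfl

theorem lCoeff_eq_zero_of_notMem_range (X Y : ℂ) (n : ℤ)
    (hn : n ∉ Set.range ((↑) : ℕ → ℤ)) : lCoeff X Y n = 0 :=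
  lCoeff_of_neg X Y (by
    by_contra h
    exact hn ⟨n.toNat, Int.toNat_of_nonneg (not_lt.1 h)⟩)

variable {X Y : ℂ}

theorem summable_norm_lCoeff (hX : ‖X‖ < 1) (hY : ‖Y‖ < 1) :
    Summable fun n => ‖lCoeff X Y n‖ := by
  rw [← Nat.cast_injective.summable_iff (f := fun n : ℤ => ‖lCoeff X Y n‖) fun n hn => by
    rw [lCoeff_eq_zero_of_notMem_range X Y n hn, norm_zero]]
  exact summable_norm_sum_mul_antidiagonal_of_summable_norm
    (summable_norm_geometric_of_norm_lt_one hX) (summable_norm_geometric_of_norm_lt_one hY)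

/-- This is the Cauchy product of two geometric series. -/
theorem tsum_lCoeff (hX : ‖X‖ < 1) (hY : ‖Y‖ < 1) :
    ∑' n, lCoeff X Y n = (1 - X)⁻¹ * (1 - Y)⁻¹ := by
  rw [← Nat.cast_injective.tsum_eq (f := lCoeff X Y) fun n hn => by
      by_contra h
      exact hn (lCoeff_eq_zero_of_notMem_range X Y n h),
    ← tsum_geometric_of_norm_lt_one hX, ← tsum_geometric_of_norm_lt_one hY,
    tsum_mul_tsum_eq_tsum_sum_antidiagonal_of_summable_norm
      (summable_norm_geometric_of_norm_lt_one hX) (summable_norm_geometric_of_norm_lt_one hY)]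
  rfl

variable {F : Type*} [Field F] [ValuativeRel F] [TopologicalSpace F]
  [IsNonarchimedeanLocalField F]

theorem unramifiedChar_eq {μ : Fˣ →* ℂˣ} (hμ : IsUnramifiedChar μ) {ϖ : Fˣ}
    (hϖ : IsUniformizer ϖ) (α : Fˣ) : (μ α : ℂ) = (μ ϖ : ℂ) ^ ord α := by
  have h1 : μ ((ϖ ^ ord α)⁻¹ * α) = 1 := hμ _ (by
    rw [valuation_eq_one_iff, ord_mul, ord_inv, ord_zpow, ord_uniformizer hϖ]
    ring)
  rw [map_mul, map_inv, map_zpow, inv_mul_eq_one] at h1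
  rw [← h1, Units.val_zpow_eq_zpow_val]

theorem IsSphericalWhittaker.innerIntegrand_eq [Fintype 𝓀[F]] {ψ : AddChar F Circle} {ϖ : Fˣ}
    {W : GL (Fin 2) F → ℂ} (hW : IsSphericalWhittaker ψ ϖ X Y W) (hψ : IsUnramifiedAddChar ψ)
    (hϖ : IsUniformizer ϖ) {μ : Fˣ →* ℂˣ} (hμ : IsUnramifiedChar μ) {k : GL (Fin 2) F}
    (hk : k ∈ maxCompact F) (u : F) (s : ℂ) (α : Fˣ) :
    innerIntegrand ψ W k u μ s α =
      lCoeff (X * ((μ ϖ : ℂ) * (resCard F : ℂ) ^ (-s)))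
        (Y * ((μ ϖ : ℂ) * (resCard F : ℂ) ^ (-s))) (ord α) * (ψ (u * α) : ℂ) := by
  rw [innerIntegrand, hW.mul_maxCompact _ _ hk]
  rcases lt_or_ge (ord α) 0 with h | h
  · rw [lCoeff_of_neg _ _ h, hW.diag_eq_zero hψ fun hα => ?_]
    · ring
    · exact absurd ((valuation_le_one_iff α).1 hα) (not_le.2 h)
  · obtain ⟨n, hn⟩ := Int.eq_ofNat_of_zero_le h
    have hq : (resCard F : ℂ) ≠ 0 := by
      exact_mod_cast (zero_lt_one.trans (one_lt_resCard (F := F))).ne'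
    -- The shift by `1/2` supplies exactly the `q^{n/2}` that normalizes the Whittaker values.
    have hs : -(s - 1 / 2) = -s + 1 / 2 := by ring
    rw [unramifiedChar_eq hμ hϖ, nabsPow_eq, hn, lCoeff_natCast, ← completeSymm_mul_pow,
      ← hW.diag_eq hψ hϖ hn, zpow_natCast, zpow_natCast, hs, Complex.cpow_add _ _ hq, mul_pow,
      mul_pow]
    ring

theorem norm_mul_resCard_cpow_lt_one {χ μ : Fˣ →* ℂˣ} {ϖ : Fˣ} {s : ℂ}
    (h : ‖((χ * μ) ϖ : ℂ)‖ < (resCard F : ℝ) ^ s.re) :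
    ‖(χ ϖ : ℂ) * ((μ ϖ : ℂ) * (resCard F : ℂ) ^ (-s))‖ < 1 := by
  have hq : 0 < resCard F := zero_lt_one.trans one_lt_resCard
  have hq' : (0 : ℝ) < resCard F := by exact_mod_cast hq
  have hp := Real.rpow_pos_of_pos hq' s.re
  rw [← mul_assoc, norm_mul, Complex.norm_natCast_cpow_of_pos hq, Complex.neg_re,
    Real.rpow_neg hq'.le, ← div_eq_mul_inv, div_lt_one hp]
  simpa using h

variable [MeasurableSpace F] [BorelSpace F]

theorem IsSphericalWhittaker.integrable_innerIntegrand [Fintype 𝓀[F]] {ψ : AddChar F Circle}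
    {ϖ : Fˣ} {W : GL (Fin 2) F → ℂ} (hW : IsSphericalWhittaker ψ ϖ X Y W)
    (hψ : IsUnramifiedAddChar ψ) (hϖ : IsUniformizer ϖ) {μ : Fˣ →* ℂˣ}
    (hμ : IsUnramifiedChar μ) {k : GL (Fin 2) F} (hk : k ∈ maxCompact F) (u : F) {s : ℂ}
    {dt : Measure Fˣ} (hdt : dt.map ord = Measure.count)
    (hX : ‖X * ((μ ϖ : ℂ) * (resCard F : ℂ) ^ (-s))‖ < 1)
    (hY : ‖Y * ((μ ϖ : ℂ) * (resCard F : ℂ) ^ (-s))‖ < 1) :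
    Integrable (innerIntegrand ψ W k u μ s) dt := by
  rw [funext (hW.innerIntegrand_eq hψ hϖ hμ hk u s)]
  have hi := integrable_comp_ord hdt (summable_norm_lCoeff hX hY)
  have hc : Continuous fun α : Fˣ => (ψ (u * α) : ℂ) :=
    Continuous.comp (g := ((↑) : Circle → ℂ)) (by fun_prop)
      ((continuous_of_isUnramifiedAddChar hψ).comp
      (continuous_const.mul Units.continuous_val))
  -- For arbitrary `u` the factor `ψ(uα)` only has absolute value one, which is enough for
  -- integrability.
  exact hi.mul_bdd (c := 1) hc.aestronglyMeasurable
    (Filter.Eventually.of_forall fun α => (Circle.norm_coe _).le)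

theorem IsSphericalWhittaker.innerZeta_eq [Fintype 𝓀[F]] {ψ : AddChar F Circle}
    {ϖ : Fˣ} {W : GL (Fin 2) F → ℂ} (hW : IsSphericalWhittaker ψ ϖ X Y W)
    (hψ : IsUnramifiedAddChar ψ) (hϖ : IsUniformizer ϖ) {μ : Fˣ →* ℂˣ}
    (hμ : IsUnramifiedChar μ) {k : GL (Fin 2) F} (hk : k ∈ maxCompact F) {u : F}
    (hu : u ∈ 𝒪[F]) {s : ℂ} {dt : Measure Fˣ} (hdt : dt.map ord = Measure.count)
    (hX : ‖X * ((μ ϖ : ℂ) * (resCard F : ℂ) ^ (-s))‖ < 1)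
    (hY : ‖Y * ((μ ϖ : ℂ) * (resCard F : ℂ) ^ (-s))‖ < 1) :
    innerZeta dt ψ W k u μ s =
      (1 - X * ((μ ϖ : ℂ) * (resCard F : ℂ) ^ (-s)))⁻¹ *
        (1 - Y * ((μ ϖ : ℂ) * (resCard F : ℂ) ^ (-s)))⁻¹ := by
  rw [innerZeta, ← tsum_lCoeff hX hY, ← integral_comp_ord hdt (summable_norm_lCoeff hX hY)]
  refine integral_congr_ae (Filter.Eventually.of_forall fun α => ?_)
  simp only [hW.innerIntegrand_eq hψ hϖ hμ hk u s]
  rcases lt_or_ge (ord α) 0 with h | h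
  · rw [lCoeff_of_neg _ _ h, zero_mul]
  · rw [(hψ u).2 hu _ ((valuation_le_one_iff α).2 h), Circle.coe_one, mul_one]

end Inner

/-! ### Support of the outer integrand and its volume. -/

section Outer

variable {F : Type*} [Field F] [ValuativeRel F]

/-- Unit scalars lie in `K` and so fix the spherical vector. -/
theorem unramified_of_isCentralChar [TopologicalSpace F] {V : Type*} [AddCommGroup V] [Module ℂ V]
    {π : Representation ℂ (GL (Fin 2) F) V} (hπ : IsSpherical π) {ω : Fˣ →* ℂˣ}
    (hω : IsCentralChar π ω) : IsUnramifiedChar ω := by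
  intro z hz
  obtain ⟨v, hv, hK⟩ := hπ.exists_fixed
  have h1 := hω z v
  rw [scalar_eq_diag, hK _ (diag_mem_maxCompact hz hz)] at h1
  refine Units.ext ?_
  exact smul_left_injective ℂ hv (by simpa using h1.symm)

theorem mem_integer_mul_iff {a x : F} (ha : valuation F a = 1) : a * x ∈ 𝒪[F] ↔ x ∈ 𝒪[F] := by
  rw [Valuation.mem_integer_iff, Valuation.mem_integer_iff, map_mul, ha, one_mul]

variable (F) in
/-- The support of the zeta integrand. -/
def zetaSupport : Set (F × F × Fˣ × maxCompact F × maxCompact F) :=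
  (𝒪[F] : Set F) ×ˢ (𝒪[F] : Set F) ×ˢ {x : Fˣ | valuation F (x : F) = 1} ×ˢ
    (Set.univ : Set (maxCompact F)) ×ˢ (Set.univ : Set (maxCompact F))

theorem integral_pair_iff (u v : F) (ε : Fˣ) :
    (!![((ε⁻¹ : Fˣ) : F), ((ε⁻¹ : Fˣ) : F) * v; 0, 0] ∈ integralMatrices F ∧
      !![0, -(u * (ε : F)); 0, (ε : F)] ∈ integralMatrices F) ↔
    u ∈ 𝒪[F] ∧ v ∈ 𝒪[F] ∧ valuation F (ε : F) = 1 := by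
  constructor
  · rintro ⟨hA, hB⟩
    have h1 : valuation F ((ε⁻¹ : Fˣ) : F) ≤ 1 := hA 0 0
    have h2 : ((ε⁻¹ : Fˣ) : F) * v ∈ 𝒪[F] := hA 0 1
    have h3 : -(u * (ε : F)) ∈ 𝒪[F] := hB 0 1
    have h4 : valuation F (ε : F) ≤ 1 := hB 1 1
    have hε : valuation F (ε : F) = 1 := by
      refine le_antisymm h4 ?_
      rw [Units.val_inv_eq_inv_val, map_inv₀] at h1
      exact (inv_le_one₀ (by simp [zero_lt_iff])).1 h1
    have hε' : valuation F ((ε⁻¹ : Fˣ) : F) = 1 := by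
      rw [Units.val_inv_eq_inv_val, map_inv₀, hε, inv_one]
    rw [neg_mem_iff, mul_comm, mem_integer_mul_iff hε] at h3
    exact ⟨h3, (mem_integer_mul_iff hε').1 h2, hε⟩
  · rintro ⟨hu, hv, hε⟩
    have hε' : valuation F ((ε⁻¹ : Fˣ) : F) = 1 := by
      rw [Units.val_inv_eq_inv_val, map_inv₀, hε, inv_one]
    have h1 : ((ε⁻¹ : Fˣ) : F) ∈ 𝒪[F] := hε'.le
    have h2 : (ε : F) ∈ 𝒪[F] := hε.le
    constructor
    · intro i j
      fin_cases i <;> fin_cases j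
      exacts [h1, mul_mem h1 hv, zero_mem _, zero_mem _]
    · intro i j
      fin_cases i <;> fin_cases j
      exacts [zero_mem _, neg_mem (mul_mem hu h2), zero_mem _, h2]

theorem charFun_conj {k k' : GL (Fin 2) F} (hk : k ∈ maxCompact F) (hk' : k' ∈ maxCompact F)
    (A B : Matrix (Fin 2) (Fin 2) F) :
    charFun F (k.val * A * k'.val, k.val * B * k'.val) = charFun F (A, B) := by
  have h : (k.val * A * k'.val, k.val * B * k'.val) ∈ integralMatrices F ×ˢ integralMatrices F ↔
      (A, B) ∈ integralMatrices F ×ˢ integralMatrices F :=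
    and_congr (conj_mem_integralMatrices_iff hk hk' A) (conj_mem_integralMatrices_iff hk hk' B)
  rw [charFun, charFun]
  by_cases hAB : (A, B) ∈ integralMatrices F ×ˢ integralMatrices F
  · rw [Set.indicator_of_mem hAB, Set.indicator_of_mem (h.2 hAB)]
    rfl
  · rw [Set.indicator_of_notMem hAB, Set.indicator_of_notMem (mt h.1 hAB)]

theorem zetaMeasure_zetaSupport [MeasurableSpace F] [MeasurableSpace (GL (Fin 2) F)]
    {dx : Measure F} [SFinite dx] (hdx : dx (𝒪[F] : Set F) = 1)
    {dt : Measure Fˣ} [SFinite dt] (hdt : dt {x : Fˣ | valuation F (x : F) = 1} = 1)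
    {dk : Measure (maxCompact F)} [SFinite dk] (hdk : dk Set.univ = 1) :
    zetaMeasure dx dt dk (zetaSupport F) = 1 := by
  rw [zetaMeasure, zetaSupport, Measure.prod_prod, Measure.prod_prod, Measure.prod_prod,
    Measure.prod_prod, hdx, hdt, hdk]
  simp

variable [TopologicalSpace F] [IsNonarchimedeanLocalField F] [MeasurableSpace F]

/-- The inner integrals need evaluation only for integral `u` and `v`, since `f` vanishes elsewhere.
-/
theorem zetaIntegrand_eq_indicator {dt : Measure Fˣ} {ψ : AddChar F Circle}
    {W₁ W₂ : GL (Fin 2) F → ℂ} {ω₂ μ : Fˣ →* ℂˣ} (hω₂ : IsUnramifiedChar ω₂) {s₁ s₂ L₁ L₂ : ℂ}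
    (h₁ : ∀ k ∈ maxCompact F, ∀ u ∈ 𝒪[F], innerZeta dt ψ W₁ k u μ s₁ = L₁)
    (h₂ : ∀ k ∈ maxCompact F, ∀ v ∈ 𝒪[F], innerZeta dt ψ W₂ k v μ⁻¹ s₂ = L₂) :
    zetaIntegrand dt ψ W₁ W₂ (charFun F) ω₂ μ s₁ s₂ =
      (zetaSupport F).indicator fun _ => L₁ * L₂ := by
  funext ⟨u, v, ε, k₁, k₂⟩
  rw [zetaIntegrand, charFun_conj (k₁⁻¹).2 k₂.2]
  have hiff : (!![((ε⁻¹ : Fˣ) : F), ((ε⁻¹ : Fˣ) : F) * v; 0, 0],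
      !![0, -(u * (ε : F)); 0, (ε : F)]) ∈ integralMatrices F ×ˢ integralMatrices F ↔ _ :=
    integral_pair_iff u v ε
  by_cases h : u ∈ 𝒪[F] ∧ v ∈ 𝒪[F] ∧ valuation F (ε : F) = 1
  · have hmem : (u, v, ε, k₁, k₂) ∈ zetaSupport F := ⟨h.1, h.2.1, h.2.2, trivial, trivial⟩
    rw [Set.indicator_of_mem hmem, charFun, Set.indicator_of_mem (hiff.2 h), hω₂ ε h.2.2,
      h₁ _ k₁.2 u h.1, h₂ _ k₂.2 v h.2.1, nabsPow_eq, (valuation_eq_one_iff ε).1 h.2.2]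
    simp
  · have hmem : (u, v, ε, k₁, k₂) ∉ zetaSupport F := fun hm => h ⟨hm.1, hm.2.1, hm.2.2.1⟩
    rw [Set.indicator_of_notMem hmem, charFun, Set.indicator_of_notMem (mt hiff.1 h)]
    simp

variable [BorelSpace F] [MeasurableSpace (GL (Fin 2) F)]

theorem measurableSet_zetaSupport : MeasurableSet (zetaSupport F) := by
  have hO : MeasurableSet (𝒪[F] : Set F) :=
    (Valuation.isOpen_integer (v := valuation F)).measurableSet
  have hU : MeasurableSet {x : Fˣ | valuation F (x : F) = 1} := by
    simp only [valuation_eq_one_iff]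
    exact continuous_ord.measurable (measurableSet_singleton 0)
  exact hO.prod (hO.prod (hU.prod (MeasurableSet.univ.prod MeasurableSet.univ)))

end Outer

end LocalGL2

end

/-! ### Assembly: a constant integrated over a set of volume one. -/

open LocalGL2 ValuativeRel MeasureTheory
theorem mainTheorem8
    {F : Type*} [Field F] [ValuativeRel F] [TopologicalSpace F] [IsNonarchimedeanLocalField F]
    [MeasurableSpace F] [BorelSpace F]
    [MeasurableSpace (GL (Fin 2) F)] [BorelSpace (GL (Fin 2) F)]
    -- normalized Haar measures on `F`, `Fˣ` and `K`
    (dx : Measure F) [dx.IsAddHaarMeasure] (hdx : dx (𝒪[F] : Set F) = 1)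
    (dt : Measure Fˣ) [dt.IsHaarMeasure] (hdt : dt {x : Fˣ | valuation F (x : F) = 1} = 1)
    (dk : Measure (maxCompact F)) [dk.IsHaarMeasure] (hdk : dk Set.univ = 1)
    (ϖ : Fˣ) (hϖ : IsUniformizer ϖ)
    (ψ : AddChar F Circle) (hψ : IsUnramifiedAddChar ψ)
    {V₁ V₂ : Type*} [AddCommGroup V₁] [Module ℂ V₁] [AddCommGroup V₂] [Module ℂ V₂]
    (π₁ : Representation ℂ (GL (Fin 2) F) V₁) (π₂ : Representation ℂ (GL (Fin 2) F) V₂)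
    (hπ₁ : IsSpherical π₁) (hπ₂ : IsSpherical π₂)
    -- Satake parameters of `π₁` and `π₂`
    (χ₁ χ₁' χ₂ χ₂' : Fˣ →* ℂˣ) (hχ₁ : IsSatake π₁ χ₁ χ₁') (hχ₂ : IsSatake π₂ χ₂ χ₂')
    (ω₁ ω₂ : Fˣ →* ℂˣ) (hω₁ : IsCentralChar π₁ ω₁) (hω₂ : IsCentralChar π₂ ω₂)
    (hω : ω₁ * ω₂ = 1)
    (W₁ W₂ : GL (Fin 2) F → ℂ)
    (hW₁ : W₁ ∈ whittakerModel π₁ ψ) (hW₂ : W₂ ∈ whittakerModel π₂ ψ)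
    (hK₁ : IsNormalizedSpherical W₁) (hK₂ : IsNormalizedSpherical W₂)
    (μ : Fˣ →* ℂˣ) (hμ : IsUnramifiedChar μ)
    (s₁ s₂ : ℂ)
    -- the half-planes to the right of the poles of `L(s, π₁, μ)` and of `L(s, π₂, μ⁻¹)`
    (hs₁ : ‖((χ₁ * μ) ϖ : ℂ)‖ < (resCard F : ℝ) ^ s₁.re)
    (hs₁' : ‖((χ₁' * μ) ϖ : ℂ)‖ < (resCard F : ℝ) ^ s₁.re)
    (hs₂ : ‖((χ₂ * μ⁻¹) ϖ : ℂ)‖ < (resCard F : ℝ) ^ s₂.re)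
    (hs₂' : ‖((χ₂' * μ⁻¹) ϖ : ℂ)‖ < (resCard F : ℝ) ^ s₂.re) :
    ZetaConverges dx dt dk ψ W₁ W₂ (charFun F) ω₂ μ s₁ s₂ ∧
    zetaIntegral dx dt dk ψ W₁ W₂ (charFun F) ω₂ μ s₁ s₂ =
      sphericalL ϖ χ₁ χ₁' μ s₁ * sphericalL ϖ χ₂ χ₂' μ⁻¹ s₂ := by
  have := Fintype.ofFinite 𝓀[F]
  have := sigmaCompactSpace hϖ
  have hcount := map_ord_eq_count dt hdt hϖ
  -- Sigma-finiteness is pulled back along `ord` from counting measure on `ℤ`; the product formula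
  -- for volumes requires it.
  have : SigmaFinite dt :=
    SigmaFinite.of_map dt continuous_ord.aemeasurable (by rw [hcount]; infer_instance)
  have : IsFiniteMeasure dk := ⟨by rw [hdk]; exact ENNReal.one_lt_top⟩
  have hμ' : IsUnramifiedChar μ⁻¹ := fun x hx => by
    rw [MonoidHom.inv_apply, hμ x hx, inv_one]
  have hw₁ := isSphericalWhittaker hπ₁ hχ₁ hω₁ hW₁ hK₁ hϖ
  have hw₂ := isSphericalWhittaker hπ₂ hχ₂ hω₂ hW₂ hK₂ hϖ
  have hX₁ := norm_mul_resCard_cpow_lt_one hs₁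
  have hY₁ := norm_mul_resCard_cpow_lt_one hs₁'
  have hX₂ := norm_mul_resCard_cpow_lt_one hs₂
  have hY₂ := norm_mul_resCard_cpow_lt_one hs₂'
  have hL : ∀ (χ χ' ν : Fˣ →* ℂˣ) (s : ℂ), sphericalL ϖ χ χ' ν s =
      (1 - (χ ϖ : ℂ) * ((ν ϖ : ℂ) * (resCard F : ℂ) ^ (-s)))⁻¹ *
        (1 - (χ' ϖ : ℂ) * ((ν ϖ : ℂ) * (resCard F : ℂ) ^ (-s)))⁻¹ := fun χ χ' ν s => by
    simp only [sphericalL, tateL, MonoidHom.mul_apply, Units.val_mul, mul_assoc]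
  have h₁ : ∀ k ∈ maxCompact F, ∀ u ∈ 𝒪[F],
      innerZeta dt ψ W₁ k u μ s₁ = sphericalL ϖ χ₁ χ₁' μ s₁ := fun k hk u hu => by
    rw [hL, hw₁.innerZeta_eq hψ hϖ hμ hk hu hcount hX₁ hY₁]
  have h₂ : ∀ k ∈ maxCompact F, ∀ v ∈ 𝒪[F],
      innerZeta dt ψ W₂ k v μ⁻¹ s₂ = sphericalL ϖ χ₂ χ₂' μ⁻¹ s₂ := fun k hk v hv => by
    rw [hL, hw₂.innerZeta_eq hψ hϖ hμ' hk hv hcount hX₂ hY₂]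
  have hZ := zetaIntegrand_eq_indicator (unramified_of_isCentralChar hπ₂ hω₂) h₁ h₂
  have hvol := zetaMeasure_zetaSupport hdx hdt hdk
  refine ⟨⟨fun k hk u => hw₁.integrable_innerIntegrand hψ hϖ hμ hk u hcount hX₁ hY₁,
    fun k hk v => hw₂.integrable_innerIntegrand hψ hϖ hμ' hk v hcount hX₂ hY₂, ?_⟩, ?_⟩
  · rw [hZ, integrable_indicator_iff measurableSet_zetaSupport]
    exact integrableOn_const (by rw [hvol]; exact ENNReal.one_ne_top)
  · rw [zetaIntegral, hZ, integral_indicator_const _ measurableSet_zetaSupport, Measure.real, hvol]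
    simp
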